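/- Let $n\ge 2$, let $1\le k\le\infty$, let $f:\mathbb{R}^n\to\mathbb{R}^n$ be of class $C^{k+1}$ with Jacobian $A(x)=\partial f/\partial x$, and consider the autonomous system $\dot x=f(x)$. For a $C^1$ matrix field $M(x)$ write $\dot M(x)=\frac{\partial M}{\partial x}\cdot f(x)$ for its derivative along solutions. Let $K\subset\mathbb{R}^n$ be a compact transverse contraction region, that is: $K$ is compact and strictly forward invariant (every solution starting in $K$ lies in the interior of $K$ at all later times), and there are a rate $\lambda>0$ and a symmetric matrix field $M$, of class $C^k$ on an open neighbourhood of $K$ and uniformly positive definite on $K$, such that $$\delta_x^{T}\bigl(\dot M+A^{T}M+MA+2\lambda M\bigr)\delta_x\le 0$$ for all $x\in K$ and all $\delta_x\neq 0$ with $f(x)^{T}M(x)\,\delta_x=0$. Assume that $K$ contains no equilibrium, i.e. $f(x)\neq 0$ for all $x\in K$. Then there exists a differential change of coordinates $\delta_y=\Theta(x)\,\delta_x$, where $\Theta$ is an $n\times n$ matrix field of class $C^k$ on an open neighbourhood of $K$ with $\Theta^{T}\Theta$ uniformly positive definite on $K$, such that the generalized Jacobian $F=(\Theta A+\dot\Theta)\Theta^{-1}$,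 with symmetric part $F_s=\tfrac12(F+F^{T})$ and eigenvalues $\lambda_1(F_s)\ge\lambda_2(F_s)\ge\dots\ge\lambda_n(F_s)$, satisfies, for some constant $c>0$, $$\lambda_1(F_s(x))=0\quad\text{and}\quad\lambda_2(F_s(x))\le -c\qquad\text{for all }x\in K.$$ -/

import Mathlib

open Set Matrix
open scoped ContDiff

noncomputable section

namespace TransverseContraction

variable {n : ℕ}

/-- The Jacobian matrix `A(x) = ∂f/∂x` of a vector field on `ℝⁿ`. -/
def jacobian (f : (Fin n → ℝ) → (Fin n → ℝ)) (x : Fin n → ℝ) : Matrix (Fin n) (Fin n) ℝ :=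
  LinearMap.toMatrix' (fderiv ℝ f x : (Fin n → ℝ) →ₗ[ℝ] (Fin n → ℝ))

/-- A matrix field `M` is of class `C^k` on (an open neighbourhood of) the set `K`. -/
def SmoothOn (k : WithTop ℕ∞) (M : (Fin n → ℝ) → Matrix (Fin n) (Fin n) ℝ)
    (K : Set (Fin n → ℝ)) : Prop :=
  ∃ U : Set (Fin n → ℝ), IsOpen U ∧ K ⊆ U ∧ ∀ i j, ContDiffOn ℝ k (fun x => M x i j) U

/-- The derivative of a matrix field along the solutions of `ẋ = f(x)`: the matrix
`d/dt M(x(t))`, whose `(i,j)` entry is `(∂Mᵢⱼ/∂x) · f(x)`. -/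
def flowDeriv (f : (Fin n → ℝ) → (Fin n → ℝ)) (M : (Fin n → ℝ) → Matrix (Fin n) (Fin n) ℝ)
    (x : Fin n → ℝ) : Matrix (Fin n) (Fin n) ℝ :=
  Matrix.of fun i j => fderiv ℝ (fun y => M y i j) x (f x)

/-- Symmetric and uniformly positive definite on `K`. -/
def UniformlyPosDefOn (M : (Fin n → ℝ) → Matrix (Fin n) (Fin n) ℝ) (K : Set (Fin n → ℝ)) : Prop :=
  (∀ x ∈ K, (M x).IsSymm) ∧
    ∃ a : ℝ, 0 < a ∧ ∀ x ∈ K, ∀ v : Fin n → ℝ, a * (v ⬝ᵥ v) ≤ v ⬝ᵥ (M x *ᵥ v)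

/-- Every solution of `ẋ = f(x)` that starts in `K` lies in the interior of `K` at all later
times at which it is defined. -/
def StrictlyForwardInvariant (f : (Fin n → ℝ) → (Fin n → ℝ)) (K : Set (Fin n → ℝ)) : Prop :=
  ∀ (γ : ℝ → Fin n → ℝ) (T : ℝ), IsIntegralCurveOn γ (fun _ => f) (Icc 0 T) → γ 0 ∈ K →
    ∀ t ∈ Ioc 0 T, γ t ∈ interior K

/-- `M` is a transverse contraction metric of class `C^k` and rate `lam` on `K` for `ẋ = f(x)`. -/
structure IsTransverseContractionMetric (k : WithTop ℕ∞) (f : (Fin n → ℝ) → (Fin n → ℝ))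
    (K : Set (Fin n → ℝ)) (M : (Fin n → ℝ) → Matrix (Fin n) (Fin n) ℝ) (lam : ℝ) : Prop where
  smooth : SmoothOn k M K
  posDef : UniformlyPosDefOn M K
  contraction : ∀ x ∈ K, ∀ v : Fin n → ℝ, v ≠ 0 → f x ⬝ᵥ (M x *ᵥ v) = 0 →
    v ⬝ᵥ ((flowDeriv f M x + (jacobian f x)ᵀ * M x + M x * jacobian f x
      + (2 * lam) • M x) *ᵥ v) ≤ 0

/-- `K` is a compact transverse contraction region of `ẋ = f(x)`, with a metric of class `C^k`. -/
structure IsCompactTransverseContractionRegion (k : WithTop ℕ∞) (f : (Fin n → ℝ) → (Fin n → ℝ))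
    (K : Set (Fin n → ℝ)) : Prop where
  compact : IsCompact K
  invariant : StrictlyForwardInvariant f K
  exists_metric : ∃ (M : (Fin n → ℝ) → Matrix (Fin n) (Fin n) ℝ) (lam : ℝ),
    0 < lam ∧ IsTransverseContractionMetric k f K M lam

/-- A differential change of coordinates `δy = Θ(x) δx` of class `C^k` on `K`: a smooth square
factor `Θ` of a uniformly positive definite metric `ΘᵀΘ`. In particular `Θ(x)` is invertible
for `x ∈ K`. -/
structure IsDifferentialChangeOfCoordinates (k : WithTop ℕ∞)
    (Θ : (Fin n → ℝ) → Matrix (Fin n) (Fin n) ℝ) (K : Set (Fin n → ℝ)) : Prop where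
  smooth : SmoothOn k Θ K
  posDef : UniformlyPosDefOn (fun x => (Θ x)ᵀ * Θ x) K

/-- The generalized Jacobian `F = (Θ A + dΘ/dt) Θ⁻¹`. -/
def generalizedJacobian (f : (Fin n → ℝ) → (Fin n → ℝ))
    (Θ : (Fin n → ℝ) → Matrix (Fin n) (Fin n) ℝ) (x : Fin n → ℝ) : Matrix (Fin n) (Fin n) ℝ :=
  (Θ x * jacobian f x + flowDeriv f Θ x) * (Θ x)⁻¹

/-- The symmetric part `F_s = (F + Fᵀ) / 2`. -/
def symPart (F : Matrix (Fin n) (Fin n) ℝ) : Matrix (Fin n) (Fin n) ℝ :=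
  (1 / 2 : ℝ) • (F + Fᵀ)

theorem symPart_isHermitian (F : Matrix (Fin n) (Fin n) ℝ) : (symPart F).IsHermitian := by
  ext i j
  simp [symPart]
  ring

/-- The eigenvalues of the symmetric part of `F`, with multiplicity, in non-increasing order:
the value at `i` is the `(i+1)`-st largest eigenvalue. -/
def symEigenvalue (F : Matrix (Fin n) (Fin n) ℝ) (i : Fin n) : ℝ :=
  (symPart_isHermitian F).eigenvalues₀ (i.cast (Fintype.card_fin n).symm)

end TransverseContraction

end

/-!
In the coordinates `δy = Θ δx` the generalized Jacobian satisfies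
`δyᵀ F_s δy = ½ d/dt |Θ(φ_t) Dφ_t δx|²`, where `φ` is the flow. So it is enough to find a metric
`W = ΘᵀΘ` in which the squared length of a transported tangent vector is the sum of a part that
decays at rate `2λ` and a part that is constant.

Let `α` be the covector field with `α(f) = 1` whose kernel is the `M`-orthogonal complement of `f`,
and let `P = 1 - f α`. Along a transported vector `w`, the energy `(Pw)ᵀ M (Pw)` decays at rate `2λ`
(`hasDerivAt_transverseEnergy`): what keeps `Pw` orthogonal to `f` is a correction along `f`, which
does not contribute. Since `P` kills `f`, the pullbacks of `α` under `φ_t` form a Cauchy family, and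
their limit `β` is a covector field with `β(f) = 1` that is invariant under the flow; it is the
differential of the asymptotic phase. The metric `W = PᵀMP + βᵀβ` (`phaseMetric`) has the required
form. The squared length of `f` itself is constantly `1`, so that `λ₁(F_s) = 0`, while on the
hyperplane `β = 0` the form `F_s` is at most `-λ`, so that `λ₂(F_s) ≤ -λ`
(`symEigenvalue_of_form`). The factor `Θ` comes from the Cholesky algorithm, which is smooth
(`exists_smooth_cholesky`).

The main point is that `β` is of class `C^k` and not merely continuous. The difference `h = β - α`
solves an equation `h = η + L · (h ∘ g)` over the time-`N` map `g = φ_N`, where `L` has norm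
`O(e^{-λN})` and `Dg` is bounded independently of `N`. The jet `(h, ε Dh)` solves an equation of the
same kind, and induction on the order of differentiability applies
(`exists_contDiffOn_cohomological`); for each finite order a large `N` gives enough contraction, and
`β` does not depend on `N`. This needs the flow to be of class `C^{k+1}` in space and its
differential to satisfy the variational equation. Both are derived from the inverse function theorem
for the integral equation `u - ∫ F ∘ u = x` in a space of continuous curves, after `f` has been cut
off outside a neighbourhood of `K`.
-/

universe u

namespace TransverseContraction

open Topology Filter

/-! ### Smoothness of superposition operators -/

/-- The superposition (Nemytskii) operator `u ↦ f ∘ u` on continuous functions. -/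
noncomputable def superposition {X E F : Type*} [TopologicalSpace X] [TopologicalSpace E]
    [TopologicalSpace F] (f : E → F) (hf : Continuous f) (u : C(X, E)) : C(X, F) :=
  ⟨fun x => f (u x), hf.comp u.continuous⟩

/-- Pointwise application of a continuous family of operators, as a bounded bilinear map. -/
noncomputable def pointwiseApply (X E F : Type*) [TopologicalSpace X] [CompactSpace X]
    [NormedAddCommGroup E] [NormedSpace ℝ E] [NormedAddCommGroup F] [NormedSpace ℝ F] :
    C(X, E →L[ℝ] F) →L[ℝ] C(X, E) →L[ℝ] C(X, F) :=
  LinearMap.mkContinuous₂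
    (LinearMap.mk₂ ℝ (fun (A : C(X, E →L[ℝ] F)) (u : C(X, E)) =>
        (⟨fun x => A x (u x), by fun_prop⟩ : C(X, F)))
      (fun _ _ _ => by ext; simp) (fun _ _ _ => by ext; simp)
      (fun _ _ _ => by ext; simp) (fun _ _ _ => by ext; simp)) 1
    (fun A u => by
      rw [ContinuousMap.norm_le _ (by positivity)]
      intro x
      simp only [LinearMap.mk₂_apply, ContinuousMap.coe_mk, one_mul]
      exact (A x).le_of_opNorm_le_of_le (A.norm_coe_le_norm x) (u.norm_coe_le_norm x))

@[simp] theorem pointwiseApply_apply {X E F : Type*} [TopologicalSpace X] [CompactSpace X]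
    [NormedAddCommGroup E] [NormedSpace ℝ E] [NormedAddCommGroup F] [NormedSpace ℝ F]
    (A : C(X, E →L[ℝ] F)) (u : C(X, E)) (x : X) : pointwiseApply X E F A u x = A x (u x) := rfl

theorem continuous_superposition {X E F : Type*} [TopologicalSpace X] [TopologicalSpace E]
    [TopologicalSpace F] (f : E → F) (hf : Continuous f) :
    Continuous (superposition (X := X) f hf) :=
  ContinuousMap.continuous_postcomp ⟨f, hf⟩

theorem hasFDerivAt_superposition {X : Type*} [TopologicalSpace X] [CompactSpace X]
    {E F : Type*} [NormedAddCommGroup E] [NormedSpace ℝ E] [NormedAddCommGroup F]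
    [NormedSpace ℝ F] {f : E → F} (hd : Differentiable ℝ f) (hf' : Continuous (fderiv ℝ f))
    (u : C(X, E)) :
    HasFDerivAt (superposition (X := X) f hd.continuous)
      (pointwiseApply X E F (superposition (fderiv ℝ f) hf' u)) u := by
  refine HasFDerivAt.of_isLittleO (Asymptotics.isLittleO_iff.2 fun ε hε => ?_)
  have hc : ∀ ε > 0, ∃ δ > 0, ∀ v : C(X, E), dist v u < δ →
      dist (superposition (fderiv ℝ f) hf' v) (superposition (fderiv ℝ f) hf' u) < ε :=
    Metric.continuous_iff.1 (continuous_superposition (X := X) (fderiv ℝ f) hf') u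
  obtain ⟨δ, hδ, hδε⟩ := hc ε hε
  filter_upwards [Metric.ball_mem_nhds u hδ] with w hw
  rw [ContinuousMap.norm_le _ (by positivity)]
  intro x
  have key : ∀ z ∈ Metric.ball (u x) δ, ‖fderiv ℝ f z - fderiv ℝ f (u x)‖ ≤ ε := by
    intro z hz
    -- the deviation `z - u x` is spread over all of `X` as a constant function
    have h1 : dist (u + ContinuousMap.const X (z - u x)) u < δ := by
      rw [dist_eq_norm, add_sub_cancel_left]
      refine lt_of_le_of_lt ((ContinuousMap.norm_le _ (norm_nonneg (z - u x))).2 fun _ => ?_)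
        (by simpa [dist_eq_norm] using hz)
      simp
    have h2 := (ContinuousMap.dist_apply_le_dist x).trans (hδε _ h1).le
    simpa [superposition, dist_eq_norm] using h2
  have h := (convex_ball (u x) δ).norm_image_sub_le_of_norm_hasFDerivWithin_le'
    (f := f) (f' := fderiv ℝ f) (φ := fderiv ℝ f (u x)) (C := ε) (x := u x) (y := w x)
    (fun z _ => (hd z).hasFDerivAt.hasFDerivWithinAt) key (Metric.mem_ball_self hδ)
    (lt_of_le_of_lt (ContinuousMap.dist_apply_le_dist x) hw)
  refine le_trans (by simpa [superposition] using h) ?_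
  gcongr
  exact (w - u).norm_coe_le_norm x

theorem contDiff_nat_superposition {X : Type*} [TopologicalSpace X] [CompactSpace X]
    {E : Type u} [NormedAddCommGroup E] [NormedSpace ℝ E] (m : ℕ) :
    ∀ {F : Type u} [NormedAddCommGroup F] [NormedSpace ℝ F] {f : E → F} (hf : ContDiff ℝ m f),
      ContDiff ℝ m (superposition (X := X) f hf.continuous) := by
  induction m with
  | zero =>
    intro F _ _ f hf
    exact contDiff_zero.2 (continuous_superposition f hf.continuous)
  | succ m ih =>
    intro F _ _ f hf
    have hf2 := (contDiff_succ_iff_fderiv (n := m)).1 (by exact_mod_cast hf)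
    have hder := hasFDerivAt_superposition (X := X) hf2.1 hf2.2.2.continuous
    have : ContDiff ℝ ((m : WithTop ℕ∞) + 1) (superposition (X := X) f hf.continuous) := by
      refine contDiff_succ_iff_fderiv.2 ⟨fun u => (hder u).differentiableAt, by simp, ?_⟩
      rw [show fderiv ℝ (superposition (X := X) f hf.continuous) = fun u =>
        pointwiseApply X E F (superposition (fderiv ℝ f) hf2.2.2.continuous u) from
        funext fun u => (hder u).fderiv]
      exact (pointwiseApply X E F).contDiff.comp (ih hf2.2.2)
    exact_mod_cast this

theorem contDiff_superposition {X : Type*} [TopologicalSpace X] [CompactSpace X]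
    {E F : Type u} [NormedAddCommGroup E] [NormedSpace ℝ E] [NormedAddCommGroup F]
    [NormedSpace ℝ F] {m : ℕ∞} {f : E → F} (hf : ContDiff ℝ m f) :
    ContDiff ℝ m (superposition (X := X) f hf.continuous) := by
  induction m using ENat.recTopCoe with
  | top => exact contDiff_infty.2 fun m => contDiff_nat_superposition m (contDiff_infty.1 hf m)
  | coe m => exact contDiff_nat_superposition m hf

/-! ### Smooth dependence of flows on the initial condition -/

/-- The Volterra operator `u ↦ (t ↦ ∫₀ᵗ u)` on continuous functions on `[-τ, τ]`. -/
noncomputable def volterra (E : Type*) [NormedAddCommGroup E] [NormedSpace ℝ E] {τ : ℝ}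
    (hτ : -τ ≤ τ) : C(Icc (-τ) τ, E) →L[ℝ] C(Icc (-τ) τ, E) :=
  LinearMap.mkContinuous
    { toFun := fun u => ⟨fun t => ∫ s in (0 : ℝ)..t, IccExtend hτ u s,
        (intervalIntegral.continuous_primitive
          (fun a b => (u.continuous.Icc_extend' (h := hτ)).intervalIntegrable a b) 0).comp
          continuous_subtype_val⟩
      map_add' := fun u v => by
        ext t
        exact intervalIntegral.integral_add
          ((u.continuous.Icc_extend' (h := hτ)).intervalIntegrable _ _)
          ((v.continuous.Icc_extend' (h := hτ)).intervalIntegrable _ _)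
      map_smul' := fun c u => by
        ext t
        exact intervalIntegral.integral_smul c _ } τ
    (fun u => by
      have hτ0 : 0 ≤ τ := by linarith
      rw [ContinuousMap.norm_le _ (by positivity)]
      intro t
      refine (intervalIntegral.norm_integral_le_of_norm_le_const (C := ‖u‖)
        fun s _ => u.norm_coe_le_norm _).trans ?_
      rw [mul_comm, sub_zero]
      gcongr
      exact abs_le.2 t.2)

theorem volterra_apply {E : Type*} [NormedAddCommGroup E] [NormedSpace ℝ E] {τ : ℝ}
    (hτ : -τ ≤ τ) (u : C(Icc (-τ) τ, E)) (t : Icc (-τ) τ) :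
    volterra E hτ u t = ∫ s in (0 : ℝ)..t, IccExtend hτ u s := rfl

theorem norm_volterra_le {E : Type*} [NormedAddCommGroup E] [NormedSpace ℝ E] {τ : ℝ}
    (hτ : -τ ≤ τ) (u : C(Icc (-τ) τ, E)) : ‖volterra E hτ u‖ ≤ τ * ‖u‖ := by
  unfold volterra
  exact (LinearMap.mkContinuous_norm_le _ (by linarith) _ |>.trans le_rfl |> fun h =>
    ContinuousLinearMap.le_of_opNorm_le _ h u)

/-- Constant functions, as a bounded operator. -/
noncomputable def constOperator (X E : Type*) [TopologicalSpace X] [CompactSpace X]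
    [NormedAddCommGroup E] [NormedSpace ℝ E] : E →L[ℝ] C(X, E) :=
  LinearMap.mkContinuous
    { toFun := ContinuousMap.const X
      map_add' := fun _ _ => rfl
      map_smul' := fun _ _ => rfl } 1
    (fun x => (ContinuousMap.norm_le _ (by positivity)).2 fun _ => by
      rw [one_mul]; exact le_rfl)

@[simp] theorem constOperator_apply {X E : Type*} [TopologicalSpace X] [CompactSpace X]
    [NormedAddCommGroup E] [NormedSpace ℝ E] (x : E) (t : X) : constOperator X E x t = x := rfl

/-- `φ` is the (global) flow of the autonomous vector field `F`; `φ t x` is the position at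
time `t` of the solution that starts at `x`. -/
structure IsFlow {E : Type*} [NormedAddCommGroup E] [NormedSpace ℝ E] (F : E → E)
    (φ : ℝ → E → E) : Prop where
  zero : ∀ x, φ 0 x = x
  hasDerivAt : ∀ x t, HasDerivAt (fun s => φ s x) (F (φ t x)) t

section Existence

variable {E : Type*} [NormedAddCommGroup E] [NormedSpace ℝ E]

theorem exists_isFlow [CompleteSpace E] {F : E → E} {L B : NNReal} (hL : LipschitzWith L F)
    (hB : ∀ x, ‖F x‖ ≤ B) : ∃ φ, IsFlow F φ := by
  have hloc : ∀ (T : ℝ) (x : E), ∃ γ : ℝ → E, γ 0 = x ∧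
      ∀ t ∈ Ioo (-(|T| + 1)) (|T| + 1), HasDerivAt γ (F (γ t)) t := by
    intro T x
    have hT : 0 < |T| + 1 := by positivity
    have hpl : IsPicardLindelof (fun _ => F) (tmin := -(|T| + 1)) (tmax := |T| + 1)
        ⟨0, by constructor <;> linarith⟩ x (B * ⟨|T| + 1, hT.le⟩) 0 B L :=
      IsPicardLindelof.of_time_independent (fun y _ => hB y) hL.lipschitzOnWith (by simp; rfl)
    obtain ⟨γ, h0, hγ⟩ := hpl.exists_eq_forall_mem_Icc_hasDerivWithinAt₀
    exact ⟨γ, h0, fun t ht => (hγ t (Ioo_subset_Icc_self ht)).hasDerivAt (Icc_mem_nhds ht.1 ht.2)⟩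
  choose γ h0 hγ using hloc
  refine ⟨fun t x => γ t x t, fun x => h0 0 x, fun x t => ?_⟩
  -- near `t` the diagonal solution `s ↦ γ s x s` coincides with `γ (|t| + 1) x`
  have heq : ∀ s ∈ Ioo (-(|t| + 1)) (|t| + 1), γ s x s = γ (|t| + 1) x s := by
    intro s hs
    have hs' : |s| < |t| + 1 := abs_lt.2 hs
    have hab : |(|t| + 1)| = |t| + 1 := abs_of_pos (by positivity)
    refine ODE_solution_unique_of_mem_Ioo (v := fun _ => F) (s := fun _ => univ) (K := L)
      (a := -(|s| + 1)) (b := |s| + 1) (t₀ := 0) (fun _ _ => hL.lipschitzOnWith)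
      ⟨by linarith [abs_nonneg s], by positivity⟩
      (fun r hr => ⟨hγ s x r hr, trivial⟩)
      (fun r hr => ⟨hγ (|t| + 1) x r ⟨?_, ?_⟩, trivial⟩)
      ((h0 _ _).trans (h0 _ _).symm) ⟨by linarith [neg_abs_le s], by linarith [le_abs_self s]⟩
    · rw [hab]; linarith [hr.1]
    · rw [hab]; linarith [hr.2]
  have ht : t ∈ Ioo (-(|t| + 1)) (|t| + 1) :=
    ⟨by linarith [neg_abs_le t], by linarith [le_abs_self t]⟩
  have hab : |(|t| + 1)| = |t| + 1 := abs_of_pos (by positivity)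
  have hd := hγ (|t| + 1) x t ⟨by rw [hab]; linarith [ht.1], by rw [hab]; linarith [ht.2]⟩
  rw [← heq t ht] at hd
  exact hd.congr_of_eventuallyEq (eventually_of_mem (Ioo_mem_nhds ht.1 ht.2) heq)

theorem IsFlow.eq_of_hasDerivAt {F : E → E} {φ : ℝ → E → E} (h : IsFlow F φ) {L : NNReal}
    (hL : LipschitzWith L F) {γ : ℝ → E} (hγ : ∀ t, HasDerivAt γ (F (γ t)) t) (t : ℝ) :
    γ t = φ t (γ 0) := by
  refine congrFun (ODE_solution_unique_univ (v := fun _ => F) (s := fun _ => univ) (K := L)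
    (t₀ := 0) (g := fun s => φ s (γ 0)) (fun _ => hL.lipschitzOnWith) (fun t => ⟨hγ t, trivial⟩)
    (fun t => ⟨h.hasDerivAt _ t, trivial⟩) (h.zero _).symm) t

theorem IsFlow.add {F : E → E} {φ : ℝ → E → E} (h : IsFlow F φ) {L : NNReal}
    (hL : LipschitzWith L F) (s t : ℝ) (x : E) : φ (s + t) x = φ s (φ t x) := by
  have := h.eq_of_hasDerivAt hL (γ := fun s => φ (s + t) x)
    (fun r => (h.hasDerivAt x (r + t)).comp_add_const r t) s
  simpa using this

theorem injective_defect {F : E → E} {L : NNReal} (hL : LipschitzWith L F) {τ : ℝ} (hτ : -τ ≤ τ)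
    (hτL : τ * L < 1) :
    Function.Injective fun w => w - volterra E hτ (superposition F hL.continuous w) := by
  intro w v hwv
  have hτ0 : 0 ≤ τ := by linarith
  have h1 : w - v = volterra E hτ (superposition F hL.continuous w -
      superposition F hL.continuous v) := by
    rw [map_sub, sub_eq_sub_iff_sub_eq_sub]
    exact hwv
  have h2 : ‖w - v‖ ≤ τ * L * ‖w - v‖ := by
    conv_lhs => rw [h1]
    refine (norm_volterra_le hτ _).trans ?_
    rw [mul_assoc]
    gcongr
    refine (ContinuousMap.norm_le _ (by positivity)).2 fun t => ?_
    refine (hL.norm_sub_le _ _).trans ?_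
    gcongr
    exact (w - v).norm_coe_le_norm t
  have h3 : ‖w - v‖ = 0 := by nlinarith [norm_nonneg (w - v)]
  exact sub_eq_zero.1 (norm_eq_zero.1 h3)

end Existence

section Smoothness

variable {E : Type u} [NormedAddCommGroup E] [NormedSpace ℝ E] [CompleteSpace E]

/-- The orbit segment over `[-τ, τ]` through `x`, as an element of a Banach space. -/
noncomputable def IsFlow.segment {F : E → E} {φ : ℝ → E → E} (h : IsFlow F φ) (τ : ℝ) (x : E) :
    C(Icc (-τ) τ, E) :=
  ⟨fun t => φ t x, (continuous_iff_continuousAt.2 fun t =>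
    (h.hasDerivAt x t).continuousAt).comp continuous_subtype_val⟩

theorem IsFlow.segment_eq {F : E → E} {φ : ℝ → E → E} (h : IsFlow F φ) (hF : Continuous F)
    {τ : ℝ} (hτ : -τ ≤ τ) (x : E) :
    h.segment τ x - volterra E hτ (superposition F hF (h.segment τ x)) = constOperator _ E x := by
  ext t
  have hτ0 : 0 ≤ τ := by linarith
  have hcont : Continuous fun s => F (φ s x) := hF.comp
    (continuous_iff_continuousAt.2 fun t => (h.hasDerivAt x t).continuousAt)
  have h1 : volterra E hτ (superposition F hF (h.segment τ x)) t = φ t x - x := by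
    have h2 := intervalIntegral.integral_eq_sub_of_hasDerivAt (a := 0) (b := (t : ℝ))
      (fun s _ => h.hasDerivAt x s) (hcont.intervalIntegrable _ _)
    rw [h.zero] at h2
    rw [volterra_apply, ← h2]
    refine intervalIntegral.integral_congr fun s hs => ?_
    have hs' : s ∈ Icc (-τ) τ :=
      uIcc_subset_Icc (show (0 : ℝ) ∈ Icc (-τ) τ from ⟨by linarith, hτ0⟩) t.2 hs
    simp [IccExtend_of_mem hτ _ hs', superposition, IsFlow.segment]
  rw [ContinuousMap.sub_apply, h1, constOperator_apply]
  simp [IsFlow.segment]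

/-- The defect map `u ↦ u - ∫ F ∘ u` of the integral equation has invertible derivative on short
time intervals. -/
theorem exists_equiv_hasFDerivAt_defect {F : E → E} {L : NNReal} (hF : ContDiff ℝ 1 F)
    (hL : LipschitzWith L F) {τ : ℝ} (hτ : -τ ≤ τ) (hτL : τ * L < 1) (v : C(Icc (-τ) τ, E)) :
    ∃ e : C(Icc (-τ) τ, E) ≃L[ℝ] C(Icc (-τ) τ, E),
      HasFDerivAt (fun w => w - volterra E hτ (superposition F hF.continuous w))
        (e : C(Icc (-τ) τ, E) →L[ℝ] C(Icc (-τ) τ, E)) v := by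
  have hτ0 : 0 ≤ τ := by linarith
  have hd := hF.differentiable one_ne_zero
  have hF' := hF.continuous_fderiv one_ne_zero
  set T := (volterra E hτ).comp
    (pointwiseApply (Icc (-τ) τ) E E (superposition (fderiv ℝ F) hF' v)) with hT
  have hTn : ‖T‖ < 1 := by
    refine lt_of_le_of_lt (T.opNorm_le_bound (M := τ * L) (by positivity) fun w => ?_) hτL
    refine (norm_volterra_le hτ _).trans ?_
    rw [mul_assoc]
    gcongr
    refine (ContinuousMap.norm_le _ (by positivity)).2 fun t => ?_
    exact ContinuousLinearMap.le_of_opNorm_le_of_le _ (norm_fderiv_le_of_lipschitz ℝ hL)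
      (w.norm_coe_le_norm t)
  refine ⟨ContinuousLinearEquiv.ofUnit (Units.oneSub T hTn), ?_⟩
  exact (hasFDerivAt_id v).sub ((volterra E hτ).hasFDerivAt.comp v
    (hasFDerivAt_superposition hd hF' v))

theorem IsFlow.contDiff_segment {F : E → E} {φ : ℝ → E → E} (h : IsFlow F φ) {m : ℕ∞}
    (hm : 1 ≤ m) (hF : ContDiff ℝ m F) {L : NNReal} (hL : LipschitzWith L F) {τ : ℝ}
    (hτ : -τ ≤ τ) (hτL : τ * L < 1) : ContDiff ℝ m (h.segment τ) := by
  have hm' : (1 : WithTop ℕ∞) ≤ m := by exact_mod_cast hm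
  have hm0 : (m : WithTop ℕ∞) ≠ 0 := (lt_of_lt_of_le one_pos hm').ne'
  refine contDiff_iff_contDiffAt.2 fun x => ?_
  obtain ⟨e, he⟩ := exists_equiv_hasFDerivAt_defect (hF.of_le hm') hL hτ hτL (h.segment τ x)
  have hR : ContDiffAt ℝ m
      (fun w => w - volterra E hτ (superposition F hF.continuous w)) (h.segment τ x) :=
    (contDiff_id.sub ((volterra E hτ).contDiff.comp (contDiff_superposition hF))).contDiffAt
  have hinv := hR.to_localInverse he hm0
  rw [h.segment_eq hF.continuous hτ] at hinv
  have hright := (hR.hasStrictFDerivAt' he hm0).eventually_right_inverse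
  rw [h.segment_eq hF.continuous hτ] at hright
  refine (hinv.comp x (constOperator (Icc (-τ) τ) E).contDiff.contDiffAt).congr_of_eventuallyEq ?_
  filter_upwards [(constOperator (Icc (-τ) τ) E).continuous.continuousAt.eventually hright]
    with y hy
  exact injective_defect hL hτ hτL ((h.segment_eq hF.continuous hτ y).trans hy.symm)

/-- Evaluation at `t ∈ [-τ, τ]` turns the smoothness of orbit segments into that of `φ t`. -/
theorem IsFlow.contDiff_of_abs_le {F : E → E} {φ : ℝ → E → E} (h : IsFlow F φ) {m : ℕ∞}
    (hm : 1 ≤ m) (hF : ContDiff ℝ m F) {L : NNReal} (hL : LipschitzWith L F) {τ : ℝ}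
    (hτ : -τ ≤ τ) (hτL : τ * L < 1) {t : ℝ} (ht : t ∈ Icc (-τ) τ) : ContDiff ℝ m (φ t) :=
  (ContinuousMap.evalCLM ℝ ⟨t, ht⟩ : C(Icc (-τ) τ, E) →L[ℝ] E).contDiff.comp
    (h.contDiff_segment hm hF hL hτ hτL)

theorem exists_short_time (L : NNReal) : ∃ τ : ℝ, 0 < τ ∧ τ * L < 1 := by
  refine ⟨1 / (L + 1), by positivity, ?_⟩
  rw [div_mul_eq_mul_div, one_mul, div_lt_one (by positivity)]
  linarith

theorem IsFlow.contDiff {F : E → E} {φ : ℝ → E → E} (h : IsFlow F φ) {m : ℕ∞}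
    (hm : 1 ≤ m) (hF : ContDiff ℝ m F) {L : NNReal} (hL : LipschitzWith L F) (t : ℝ) :
    ContDiff ℝ m (φ t) := by
  obtain ⟨τ, hτ, hτL⟩ := exists_short_time L
  obtain ⟨N, hN⟩ := exists_nat_ge (|t| / τ)
  have hτ' : -τ ≤ τ := by linarith
  have hiter : ∀ (s : ℝ) (hs : s ∈ Icc (-τ) τ) (j : ℕ), ContDiff ℝ m (φ (j * s)) := by
    intro s hs j
    induction j with
    | zero => simpa [funext h.zero] using contDiff_fun_id
    | succ j ih =>
      have : φ ((j + 1 : ℕ) * s) = fun x => φ s (φ (j * s) x) := by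
        funext x
        rw [← h.add hL]
        push_cast
        ring_nf
      rw [this]
      exact (h.contDiff_of_abs_le hm hF hL hτ' hτL hs).comp ih
  have hN1 : (0 : ℝ) < (N + 1 : ℕ) := by positivity
  have hst := hiter (t / (N + 1 : ℕ)) (abs_le.1 ?_) (N + 1)
  · rwa [mul_div_cancel₀ _ hN1.ne'] at hst
  · rw [abs_div, abs_of_pos hN1, div_le_iff₀ hN1]
    rw [div_le_iff₀ hτ] at hN
    push_cast
    nlinarith

theorem IsFlow.hasDerivAt_fderiv_zero {F : E → E} {φ : ℝ → E → E} (h : IsFlow F φ)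
    (hF : ContDiff ℝ 1 F) {L : NNReal} (hL : LipschitzWith L F) (x v : E) :
    HasDerivAt (fun t => fderiv ℝ (φ t) x v) (fderiv ℝ F x v) 0 := by
  obtain ⟨τ, hτ, hτL⟩ := exists_short_time L
  have hτ' : -τ ≤ τ := by linarith
  have hF' := hF.continuous_fderiv one_ne_zero
  have hseg : HasFDerivAt (h.segment τ) (fderiv ℝ (h.segment τ) x) x :=
    ((h.contDiff_segment (m := 1) le_rfl hF hL hτ' hτL).differentiable one_ne_zero
      x).hasFDerivAt
  have heval : ∀ t : Icc (-τ) τ, fderiv ℝ (φ t) x v = fderiv ℝ (h.segment τ) x v t := by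
    intro t
    have := ((ContinuousMap.evalCLM ℝ t).hasFDerivAt.comp x hseg).fderiv
    exact congrArg (fun A => A v) this
  -- differentiating the integral equation of the orbit segments in the direction `v`
  have hlin : fderiv ℝ (h.segment τ) x v - volterra E hτ' (pointwiseApply _ E E
      (superposition (fderiv ℝ F) hF' (h.segment τ x)) (fderiv ℝ (h.segment τ) x v))
      = constOperator _ E v := by
    have h1 := hseg.sub ((volterra E hτ').hasFDerivAt.comp x
      ((hasFDerivAt_superposition (hF.differentiable one_ne_zero) hF' (h.segment τ x)).comp x hseg))
    have h2 : HasFDerivAt (h.segment τ - (volterra E hτ') ∘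
        (superposition F hF.continuous ∘ h.segment τ)) (constOperator (Icc (-τ) τ) E) x := by
      refine (constOperator (Icc (-τ) τ) E).hasFDerivAt.congr_of_eventuallyEq
        (Eventually.of_forall fun y => h.segment_eq hF.continuous hτ' y)
    exact congrArg (fun A => A v) (h1.unique h2)
  set w := fderiv ℝ (h.segment τ) x v with hw
  set b : C(Icc (-τ) τ, E) := pointwiseApply _ E E
    (superposition (fderiv ℝ F) hF' (h.segment τ x)) w with hb
  have hFTC : HasDerivAt (fun t => v + ∫ s in (0 : ℝ)..t, IccExtend hτ' b s)
      (IccExtend hτ' b 0) 0 :=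
    ((b.continuous.Icc_extend' (h := hτ')).integral_hasStrictDerivAt 0 0).hasDerivAt.const_add v
  have h00 : (0 : ℝ) ∈ Icc (-τ) τ := ⟨by linarith, hτ.le⟩
  have hwt : ∀ t : Icc (-τ) τ, w t = v + ∫ s in (0 : ℝ)..t, IccExtend hτ' b s := by
    intro t
    have := congrArg (fun c : C(Icc (-τ) τ, E) => c t) hlin
    simp only [ContinuousMap.sub_apply, constOperator_apply] at this
    rw [← volterra_apply, ← this]
    abel
  have hval : IccExtend hτ' b 0 = fderiv ℝ F x v := by
    rw [IccExtend_of_mem _ _ h00]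
    have : w ⟨0, h00⟩ = v := by simpa using hwt ⟨0, h00⟩
    simp [hb, this, superposition, IsFlow.segment, h.zero]
  rw [hval] at hFTC
  refine hFTC.congr_of_eventuallyEq ?_
  filter_upwards [Icc_mem_nhds (show -τ < 0 by linarith) hτ] with t ht
  rw [← hwt ⟨t, ht⟩, ← heval ⟨t, ht⟩]

theorem IsFlow.fderiv_add {F : E → E} {φ : ℝ → E → E} (h : IsFlow F φ)
    (hF : ContDiff ℝ 1 F) {L : NNReal} (hL : LipschitzWith L F) (s t : ℝ) (x : E) :
    fderiv ℝ (φ (s + t)) x = (fderiv ℝ (φ s) (φ t x)).comp (fderiv ℝ (φ t) x) := by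
  have hd : ∀ t, Differentiable ℝ (φ t) := fun t =>
    (h.contDiff (m := 1) le_rfl hF hL t).differentiable one_ne_zero
  rw [show φ (s + t) = φ s ∘ φ t from funext (h.add hL s t)]
  exact fderiv_comp x (hd s _) (hd t x)

/-- The variational equation. -/
theorem IsFlow.hasDerivAt_fderiv {F : E → E} {φ : ℝ → E → E} (h : IsFlow F φ)
    (hF : ContDiff ℝ 1 F) {L : NNReal} (hL : LipschitzWith L F) (x v : E) (t : ℝ) :
    HasDerivAt (fun s => fderiv ℝ (φ s) x v) (fderiv ℝ F (φ t x) (fderiv ℝ (φ t) x v)) t := by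
  have h0 := h.hasDerivAt_fderiv_zero hF hL (φ t x) (fderiv ℝ (φ t) x v)
  rw [← sub_self t] at h0
  refine (h0.comp_sub_const t t).congr_of_eventuallyEq (Eventually.of_forall fun s => ?_)
  have := h.fderiv_add hF hL (s - t) t x
  rw [sub_add_cancel] at this
  simp [this]

/-- The differential of the flow transports the vector field to itself. -/
theorem IsFlow.fderiv_apply_self {F : E → E} {φ : ℝ → E → E} (h : IsFlow F φ)
    (hF : ContDiff ℝ 1 F) {L : NNReal} (hL : LipschitzWith L F) (x : E) (t : ℝ) :
    fderiv ℝ (φ t) x (F x) = F (φ t x) := by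
  have hd : DifferentiableAt ℝ (φ t) (φ 0 x) :=
    (h.contDiff (m := 1) le_rfl hF hL t).differentiable one_ne_zero _
  have h1 := hd.hasFDerivAt.comp_hasDerivAt (0 : ℝ) (h.hasDerivAt x 0)
  have h2 : HasDerivAt (φ t ∘ fun s => φ s x) (F (φ 0 (φ t x))) 0 := by
    refine (h.hasDerivAt (φ t x) 0).congr_of_eventuallyEq (Eventually.of_forall fun s => ?_)
    simp only [Function.comp_apply]
    rw [← h.add hL, ← h.add hL, add_comm]
  have := h1.unique h2
  simpa [h.zero] using this

end Smoothness

/-! ### Smooth solutions of linear cohomological equations -/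

section Cohomological

/-- The iterates, started at `0`, of the affine operator `h ↦ η + L · (h ∘ g)`. -/
def cohomIter {E F : Type*} [NormedAddCommGroup F] [NormedSpace ℝ F] (g : E → E) (η : E → F)
    (L : E → F →L[ℝ] F) : ℕ → E → F
  | 0 => fun _ => 0
  | m + 1 => fun x => η x + L x (cohomIter g η L m (g x))

section

variable {E F : Type*} [NormedAddCommGroup F] [NormedSpace ℝ F] {g : E → E} {η : E → F}
  {L : E → F →L[ℝ] F} {K : Set E} {q B : ℝ}

theorem norm_cohomIter_sub_le (hg : MapsTo g K K) (hη : ∀ x ∈ K, ‖η x‖ ≤ B)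
    (hL : ∀ x ∈ K, ‖L x‖ ≤ q) (m : ℕ) :
    ∀ x ∈ K, ‖cohomIter g η L m x - cohomIter g η L (m + 1) x‖ ≤ B * q ^ m := by
  induction m with
  | zero =>
    intro x hx
    simpa [cohomIter] using hη x hx
  | succ m ih =>
    intro x hx
    have h1 : cohomIter g η L (m + 1) x - cohomIter g η L (m + 1 + 1) x =
        L x (cohomIter g η L m (g x) - cohomIter g η L (m + 1) (g x)) := by
      rw [map_sub]
      exact add_sub_add_left_eq_sub _ _ _
    rw [h1]
    refine ((L x).le_of_opNorm_le_of_le (hL x hx) (ih _ (hg hx))).trans (le_of_eq ?_)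
    ring

theorem exists_tendstoUniformlyOn_cohomIter [CompleteSpace F] (hg : MapsTo g K K)
    (hη : ∀ x ∈ K, ‖η x‖ ≤ B) (hL : ∀ x ∈ K, ‖L x‖ ≤ q) (hq : 0 ≤ q) (hq1 : q < 1) :
    ∃ h : E → F, TendstoUniformlyOn (cohomIter g η L) h atTop K := by
  have hdist : ∀ x ∈ K, ∀ m, dist (cohomIter g η L m x) (cohomIter g η L (m + 1) x) ≤ B * q ^ m :=
    fun x hx m => by
      rw [dist_eq_norm]
      exact norm_cohomIter_sub_le hg hη hL m x hx
  have hlim : ∀ x, ∃ y, x ∈ K → Tendsto (fun m => cohomIter g η L m x) atTop (𝓝 y) := by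
    intro x
    by_cases hx : x ∈ K
    · obtain ⟨y, hy⟩ := cauchySeq_tendsto_of_complete
        (cauchySeq_of_le_geometric q B hq1 (hdist x hx))
      exact ⟨y, fun _ => hy⟩
    · exact ⟨0, fun h => absurd h hx⟩
  choose h hh using hlim
  refine ⟨h, Metric.tendstoUniformlyOn_iff.2 fun ε hε => ?_⟩
  have h0 : Tendsto (fun m => B * q ^ m / (1 - q)) atTop (𝓝 0) := by
    simpa using ((tendsto_pow_atTop_nhds_zero_of_lt_one hq hq1).const_mul B).div_const (1 - q)
  filter_upwards [h0.eventually (gt_mem_nhds hε)] with m hm x hx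
  rw [dist_comm]
  exact lt_of_le_of_lt (dist_le_of_le_geometric_of_tendsto q B hq1 (hdist x hx) (hh x hx) m) hm

/-- A bounded solution of `h = η + L · (h ∘ g)` is the limit of the iterates. -/
theorem tendsto_cohomIter_of_eq (hg : MapsTo g K K) (hL : ∀ x ∈ K, ‖L x‖ ≤ q) (hq : 0 ≤ q)
    (hq1 : q < 1) {h : E → F} (hB : ∀ x ∈ K, ‖h x‖ ≤ B)
    (heq : ∀ x ∈ K, h x = η x + L x (h (g x))) {x : E} (hx : x ∈ K) :
    Tendsto (fun m => cohomIter g η L m x) atTop (𝓝 (h x)) := by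
  have key : ∀ m, ∀ x ∈ K, ‖cohomIter g η L m x - h x‖ ≤ B * q ^ m := by
    intro m
    induction m with
    | zero =>
      intro x hx
      simpa [cohomIter] using hB x hx
    | succ m ih =>
      intro x hx
      have h1 : cohomIter g η L (m + 1) x - h x = L x (cohomIter g η L m (g x) - h (g x)) := by
        rw [heq x hx, map_sub]
        exact add_sub_add_left_eq_sub _ _ _
      rw [h1]
      refine ((L x).le_of_opNorm_le_of_le (hL x hx) (ih _ (hg hx))).trans (le_of_eq ?_)
      ring
  rw [tendsto_iff_norm_sub_tendsto_zero]
  refine squeeze_zero (fun _ => norm_nonneg _) (fun m => key m x hx) ?_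
  simpa using (tendsto_pow_atTop_nhds_zero_of_lt_one hq hq1).const_mul B

theorem continuousOn_cohomIter [TopologicalSpace E] (hg : MapsTo g K K) (hgc : ContinuousOn g K)
    (hη : ContinuousOn η K) (hL : ContinuousOn L K) (m : ℕ) :
    ContinuousOn (cohomIter g η L m) K := by
  induction m with
  | zero => exact continuousOn_const
  | succ m ih => exact hη.add (hL.clm_apply (ih.comp hgc hg))

end

variable {E : Type u} [NormedAddCommGroup E] [NormedSpace ℝ E]

section

variable {F : Type*} [NormedAddCommGroup F] [NormedSpace ℝ F] {g : E → E} {η : E → F}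
  {L : E → F →L[ℝ] F}

/-- The linear part of the cohomological equation satisfied by the `1`-jet `(h, ε Dh)` of a
solution `h`. The factor `ε` makes the off-diagonal term small. -/
noncomputable def jetOperator (ε : ℝ) (g : E → E) (L : E → F →L[ℝ] F) (x : E) :
    F × (E →L[ℝ] F) →L[ℝ] F × (E →L[ℝ] F) :=
  (ContinuousLinearMap.inl ℝ F (E →L[ℝ] F)).comp
      ((L x).comp (ContinuousLinearMap.fst ℝ F (E →L[ℝ] F))) +
    (ContinuousLinearMap.inr ℝ F (E →L[ℝ] F)).comp
      (ε • (ContinuousLinearMap.flipₗᵢ ℝ E F F (fderiv ℝ L x)).comp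
          (ContinuousLinearMap.fst ℝ F (E →L[ℝ] F)) +
        ((ContinuousLinearMap.compL ℝ E F F (L x)).comp
          ((ContinuousLinearMap.compL ℝ E E F).flip (fderiv ℝ g x))).comp
          (ContinuousLinearMap.snd ℝ F (E →L[ℝ] F)))

theorem jetOperator_apply (ε : ℝ) (g : E → E) (L : E → F →L[ℝ] F) (x : E)
    (p : F × (E →L[ℝ] F)) : jetOperator ε g L x p =
      (L x p.1, ε • (fderiv ℝ L x).flip p.1 + ((L x).comp (p.2.comp (fderiv ℝ g x)))) := by
  simp [jetOperator]

theorem norm_jetOperator_le {ε q c G : ℝ} (hε : 0 ≤ ε) (hq : 0 ≤ q) (hG : 1 ≤ G) {g : E → E}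
    {L : E → F →L[ℝ] F} {x : E} (hL : ‖L x‖ ≤ q) (hL' : ‖fderiv ℝ L x‖ ≤ c)
    (hg : ‖fderiv ℝ g x‖ ≤ G) : ‖jetOperator ε g L x‖ ≤ q * G + ε * c := by
  have hc : 0 ≤ c := (norm_nonneg (fderiv ℝ L x)).trans hL'
  refine ContinuousLinearMap.opNorm_le_bound _ (by positivity) fun p => ?_
  rw [jetOperator_apply]
  have h1 : ‖p.1‖ ≤ ‖p‖ := norm_fst_le p
  have h2 : ‖p.2‖ ≤ ‖p‖ := norm_snd_le p
  refine max_le ?_ ?_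
  · refine ((L x).le_of_opNorm_le_of_le hL h1).trans ?_
    gcongr
    nlinarith [mul_nonneg hε hc]
  · refine (norm_add_le _ _).trans ?_
    rw [norm_smul, Real.norm_of_nonneg hε]
    have h3 : ‖(fderiv ℝ L x).flip p.1‖ ≤ c * ‖p‖ :=
      ContinuousLinearMap.le_of_opNorm_le_of_le _
        ((ContinuousLinearMap.opNorm_flip _).le.trans hL') h1
    have h4 : ‖(L x).comp (p.2.comp (fderiv ℝ g x))‖ ≤ q * (‖p‖ * G) := by
      refine (ContinuousLinearMap.opNorm_comp_le _ _).trans ?_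
      gcongr
      refine (ContinuousLinearMap.opNorm_comp_le _ _).trans ?_
      gcongr
    nlinarith [mul_le_mul_of_nonneg_left h3 hε]

theorem contDiffOn_jetOperator {ε : ℝ} {k : ℕ} {V : Set E} (hV : IsOpen V)
    (hg : ContDiffOn ℝ (k + 1 : ℕ) g V) (hL : ContDiffOn ℝ (k + 1 : ℕ) L V) :
    ContDiffOn ℝ k (jetOperator ε g L) V := by
  have hk : ((k : WithTop ℕ∞)) + 1 ≤ ((k + 1 : ℕ) : WithTop ℕ∞) := by push_cast; exact le_rfl
  have hg' := hg.fderiv_of_isOpen hV hk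
  have hL' := hL.fderiv_of_isOpen hV hk
  have hL0 : ContDiffOn ℝ k L V := hL.of_le (by exact_mod_cast Nat.le_succ k)
  unfold jetOperator
  refine (contDiffOn_const.clm_comp (hL0.clm_comp contDiffOn_const)).add
    (contDiffOn_const.clm_comp (((ContDiffOn.clm_comp ?_ contDiffOn_const).const_smul ε).add
      (ContDiffOn.clm_comp (ContDiffOn.clm_comp ?_ ?_) contDiffOn_const)))
  · have h : ContDiff ℝ k fun A : E →L[ℝ] F →L[ℝ] F => ContinuousLinearMap.flipₗᵢ ℝ E F F A := by
      fun_prop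
    exact h.comp_contDiffOn hL'
  · have h : ContDiff ℝ k fun A : F →L[ℝ] F => ContinuousLinearMap.compL ℝ E F F A := by
      fun_prop
    exact h.comp_contDiffOn hL0
  · have h : ContDiff ℝ k fun A : E →L[ℝ] E => (ContinuousLinearMap.compL ℝ E E F).flip A := by
      fun_prop
    exact h.comp_contDiffOn hg'

/-- The iterates of the `1`-jet equation are the `1`-jets of the iterates. -/
theorem cohomIter_jet {ε : ℝ} {V O : Set E} (hV : IsOpen V) (hOV : O ⊆ V)
    (hgO : MapsTo g O O) (hg : DifferentiableOn ℝ g V) (hη : DifferentiableOn ℝ η V)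
    (hL : DifferentiableOn ℝ L V) (m : ℕ) :
    (∀ x, (cohomIter g (fun x => (η x, ε • fderiv ℝ η x)) (jetOperator ε g L) m x).1 =
      cohomIter g η L m x) ∧
    ∀ x ∈ O, ∃ A : E →L[ℝ] F, HasFDerivAt (cohomIter g η L m) A x ∧
      (cohomIter g (fun x => (η x, ε • fderiv ℝ η x)) (jetOperator ε g L) m x).2 = ε • A := by
  induction m with
  | zero => exact ⟨fun _ => rfl, fun x _ => ⟨0, hasFDerivAt_const _ _, by simp [cohomIter]⟩⟩
  | succ m ih =>
    refine ⟨fun x => ?_, fun x hx => ?_⟩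
    · simp [cohomIter, jetOperator_apply, ih.1]
    · obtain ⟨A, hA, hA2⟩ := ih.2 (g x) (hgO hx)
      have hVx := hV.mem_nhds (hOV hx)
      have hgd := (hg.differentiableAt hVx).hasFDerivAt
      have hηd := (hη.differentiableAt hVx).hasFDerivAt
      have hLd := (hL.differentiableAt hVx).hasFDerivAt
      refine ⟨_, hηd.add (hLd.clm_apply (hA.comp x hgd)), ?_⟩
      simp only [cohomIter, jetOperator_apply, ih.1, hA2, Prod.snd_add]
      ext v
      simp [smul_add]
      abel

end

/-- If `‖L‖ ≤ q`, `‖Dg‖ ≤ G` on a compact set `K` that `g` maps into its interior, and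
`q * G ^ k < 1`, then the bounded solution of `h = η + L · (h ∘ g)` is of class `C^k`. By induction
on `k`, since the jet `(h, ε Dh)` solves an equation of the same kind with `q` replaced by a
number close to `q * G`. -/
theorem exists_contDiffOn_cohomological {K V O : Set E} {g : E → E} {G : ℝ} (hK : IsCompact K)
    (hV : IsOpen V) (hO : IsOpen O) (hKV : K ⊆ V) (hOK : O ⊆ K) (hgO : MapsTo g K O)
    (hG : 1 ≤ G) (hgG : ∀ x ∈ K, ‖fderiv ℝ g x‖ ≤ G) (k : ℕ) :
    ∀ {F : Type u} [NormedAddCommGroup F] [NormedSpace ℝ F] [CompleteSpace F] {η : E → F}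
      {L : E → F →L[ℝ] F} {q : ℝ}, ContDiffOn ℝ k g V → ContDiffOn ℝ k η V →
      ContDiffOn ℝ k L V → 0 ≤ q → (∀ x ∈ K, ‖L x‖ ≤ q) → q * G ^ k < 1 →
      ∃ h : E → F, TendstoUniformlyOn (cohomIter g η L) h atTop K ∧ ContDiffOn ℝ k h O := by
  have hgK : MapsTo g K K := fun x hx => hOK (hgO hx)
  induction k with
  | zero =>
    intro F _ _ _ η L q hg hη hL hq hLq hqG
    obtain ⟨B, hB⟩ := hK.exists_bound_of_continuousOn (hη.continuousOn.mono hKV)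
    obtain ⟨h, hh⟩ := exists_tendstoUniformlyOn_cohomIter hgK hB hLq hq (by simpa using hqG)
    refine ⟨h, hh, contDiffOn_zero.2 ?_⟩
    exact (hh.continuousOn (Frequently.of_forall fun m => continuousOn_cohomIter hgK
      (hg.continuousOn.mono hKV) (hη.continuousOn.mono hKV) (hL.continuousOn.mono hKV) m)).mono hOK
  | succ k ih =>
    intro F _ _ _ η L q hg hη hL hq hLq hqG
    have hk : ((k : WithTop ℕ∞)) + 1 ≤ ((k + 1 : ℕ) : WithTop ℕ∞) := by push_cast; exact le_rfl
    have hk0 : ((k : ℕ) : WithTop ℕ∞) ≤ ((k + 1 : ℕ) : WithTop ℕ∞) := by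
      exact_mod_cast Nat.le_succ k
    have hk1 : ((k + 1 : ℕ) : WithTop ℕ∞) ≠ 0 := by exact_mod_cast Nat.succ_ne_zero k
    obtain ⟨c, hc⟩ := hK.exists_bound_of_continuousOn
      ((hL.fderiv_of_isOpen hV hk).continuousOn.mono hKV)
    obtain ⟨ε, hε, hεq⟩ : ∃ ε : ℝ, 0 < ε ∧ (q * G + ε * |c|) * G ^ k < 1 := by
      have hcont : Tendsto (fun ε : ℝ => (q * G + ε * |c|) * G ^ k) (𝓝[>] 0)
          (𝓝 ((q * G + 0 * |c|) * G ^ k)) :=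
        (Continuous.tendsto (by fun_prop) 0).mono_left nhdsWithin_le_nhds
      have hlt : (q * G + 0 * |c|) * G ^ k < 1 := by
        rw [pow_succ] at hqG
        linarith
      exact ((hcont.eventually (gt_mem_nhds hlt)).and self_mem_nhdsWithin).exists.imp
        fun ε h => ⟨h.2, h.1⟩
    obtain ⟨H, hH, hHk⟩ := ih (η := fun x => (η x, ε • fderiv ℝ η x)) (L := jetOperator ε g L)
      (hg.of_le hk0)
      ((hη.of_le hk0).prodMk ((hη.fderiv_of_isOpen hV hk).const_smul ε))
      (contDiffOn_jetOperator hV hg hL) (by positivity)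
      (fun x hx => norm_jetOperator_le hε.le hq hG (hLq x hx) ((hc x hx).trans (le_abs_self c))
        (hgG x hx)) hεq
    have hjet := cohomIter_jet (ε := ε) hV (hOK.trans hKV) (fun x hx => hgO (hOK hx))
      (hg.differentiableOn hk1) (hη.differentiableOn hk1) (hL.differentiableOn hk1)
    have hH1 : TendstoUniformlyOn (cohomIter g η L) (fun x => (H x).1) atTop K :=
      (uniformContinuous_fst.comp_tendstoUniformlyOn hH).congr
        (Eventually.of_forall fun m x _ => (hjet m).1 x)
    have hH2 : TendstoUniformlyOn (fun m x => ε⁻¹ •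
        (cohomIter g (fun x => (η x, ε • fderiv ℝ η x)) (jetOperator ε g L) m x).2)
        (fun x => ε⁻¹ • (H x).2) atTop O :=
      ((uniformContinuous_const_smul ε⁻¹).comp uniformContinuous_snd).comp_tendstoUniformlyOn
        (hH.mono hOK)
    have hder : ∀ x ∈ O, HasFDerivAt (fun x => (H x).1) (ε⁻¹ • (H x).2) x := by
      refine fun x hx => hasFDerivAt_of_tendstoUniformlyOn hO hH2 (fun m x hx => ?_)
        (fun x hx => hH1.tendsto_at (hOK hx)) hx
      obtain ⟨A, hA, hA2⟩ := (hjet m).2 x hx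
      rwa [hA2, inv_smul_smul₀ hε.ne']
    refine ⟨fun x => (H x).1, hH1, ?_⟩
    have : ContDiffOn ℝ ((k : WithTop ℕ∞) + 1) (fun x => (H x).1) O := by
      refine (contDiffOn_succ_iff_fderiv_of_isOpen hO).2
        ⟨fun x hx => (hder x hx).differentiableAt.differentiableWithinAt, by simp, ?_⟩
      exact (hHk.snd.const_smul ε⁻¹).congr fun x hx => (hder x hx).fderiv
    exact_mod_cast this

end Cohomological

/-! ### Smooth factorisation of positive definite matrix fields -/

/-- Smooth Cholesky factorisation. The factor is built by splitting off the first row and column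
and passing to the Schur complement; positivity on `K` suffices, since the only denominators are
pivots that stay positive near `K`. -/
theorem exists_smooth_cholesky {E : Type*} [NormedAddCommGroup E] [NormedSpace ℝ E]
    {k : WithTop ℕ∞} {K : Set E} {n : ℕ} : ∀ {W : E → Matrix (Fin n) (Fin n) ℝ} {U : Set E},
    IsOpen U → K ⊆ U → (∀ i j, ContDiffOn ℝ k (fun x => W x i j) U) →
    (∀ x ∈ K, (W x).IsSymm) → (∀ x ∈ K, ∀ v : Fin n → ℝ, v ≠ 0 → 0 < v ⬝ᵥ (W x *ᵥ v)) →
    ∃ (Θ : E → Matrix (Fin n) (Fin n) ℝ) (V : Set E), IsOpen V ∧ K ⊆ V ∧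
      (∀ i j, ContDiffOn ℝ k (fun x => Θ x i j) V) ∧ ∀ x ∈ K, (Θ x)ᵀ * Θ x = W x := by
  induction n with
  | zero =>
    intro W U hU hKU _ _ _
    exact ⟨fun _ => 0, U, hU, hKU, fun i => i.elim0, fun x _ => by ext i; exact i.elim0⟩
  | succ n ih =>
    intro W U hU hKU hW hsymm hpos
    have ha : ∀ x ∈ K, 0 < W x 0 0 := by
      intro x hx
      have := hpos x hx (Pi.single 0 1) (by simp)
      simpa using this
    set U' := U ∩ (fun x => W x 0 0) ⁻¹' Ioi 0 with hU'
    have hU'o : IsOpen U' := (hW 0 0).continuousOn.isOpen_inter_preimage hU isOpen_Ioi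
    have hKU' : K ⊆ U' := fun x hx => ⟨hKU hx, ha x hx⟩
    have hW' : ∀ i j, ContDiffOn ℝ k (fun x => W x i j) U' := fun i j =>
      (hW i j).mono inter_subset_left
    have ha0 : ∀ x ∈ U', W x 0 0 ≠ 0 := fun x hx => ne_of_gt hx.2
    obtain ⟨Θ, V, hV, hKV, hΘ, hΘW⟩ := ih (U := U')
      (W := fun x => Matrix.of fun i j => W x i.succ j.succ - W x 0 i.succ * W x 0 j.succ / W x 0 0)
      hU'o hKU' (fun i j => (hW' _ _).sub (((hW' _ _).mul (hW' _ _)).div (hW' 0 0) ha0))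
      (fun x hx => by
        ext i j
        simp only [transpose_apply, of_apply]
        rw [(hsymm x hx).apply i.succ j.succ, mul_comm (W x 0 j.succ)])
      (fun x hx w hw => by
        have hax := ha x hx
        have h := hpos x hx (Fin.cons (-(∑ j, W x 0 j.succ * w j) / W x 0 0) w) (fun h0 => hw (by
          funext j
          simpa using congrFun h0 j.succ))
        have hs : ∀ i : Fin n, W x i.succ 0 = W x 0 i.succ := fun i => (hsymm x hx).apply _ _
        refine lt_of_lt_of_eq h ?_
        set s := ∑ j, W x 0 j.succ * w j with hsdef
        set C := ∑ i, w i * ∑ j, W x i.succ j.succ * w j with hC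
        have h1 : (Fin.cons (-s / W x 0 0) w : Fin (n + 1) → ℝ) ⬝ᵥ
            (W x *ᵥ (Fin.cons (-s / W x 0 0) w : Fin (n + 1) → ℝ)) = C - s * s / W x 0 0 := by
          simp only [dotProduct, mulVec, Fin.sum_univ_succ, Fin.cons_zero, Fin.cons_succ, hs,
            mul_add, Finset.sum_add_distrib, ← hsdef, ← hC]
          have h2 : ∑ i, w i * (W x 0 i.succ * (-s / W x 0 0)) = s * (-s / W x 0 0) := by
            rw [hsdef, Finset.sum_mul]
            exact Finset.sum_congr rfl fun i _ => by ring
          rw [h2]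
          field_simp
          ring
        rw [h1]
        simp only [dotProduct, mulVec, of_apply, sub_mul, Finset.sum_sub_distrib, mul_sub, ← hC]
        congr 1
        rw [hsdef, Finset.sum_mul, Finset.sum_div]
        refine Finset.sum_congr rfl fun i _ => ?_
        rw [Finset.mul_sum, Finset.mul_sum, Finset.sum_div]
        exact Finset.sum_congr rfl fun j _ => by ring)
    have hUV : U' ∩ V ⊆ U' := inter_subset_left
    have hsq : ContDiffOn ℝ k (fun x => √(W x 0 0)) (U' ∩ V) :=
      ((hW' 0 0).mono hUV).sqrt fun x hx => ha0 x hx.1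
    have hsq0 : ∀ x ∈ U' ∩ V, √(W x 0 0) ≠ 0 := fun x hx => (Real.sqrt_pos.2 hx.1.2).ne'
    refine ⟨fun x => Matrix.of (Fin.cons (Fin.cons √(W x 0 0) fun j => W x 0 j.succ / √(W x 0 0))
      fun i => Fin.cons 0 (Θ x i)), U' ∩ V, hU'o.inter hV, fun x hx => ⟨hKU' hx, hKV hx⟩, ?_, ?_⟩
    · intro i j
      refine Fin.cases ?_ (fun i => ?_) i
      · refine Fin.cases ?_ (fun j => ?_) j
        · simpa using hsq
        · simp only [of_apply, Fin.cons_zero, Fin.cons_succ]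
          exact ((hW' 0 j.succ).mono hUV).div hsq hsq0
      · refine Fin.cases ?_ (fun j => ?_) j
        · simpa using contDiffOn_const
        · simpa using (hΘ i j).mono inter_subset_right
    · intro x hx
      have hax := ha x hx
      have hss : √(W x 0 0) * √(W x 0 0) = W x 0 0 := Real.mul_self_sqrt hax.le
      have hs0 : √(W x 0 0) ≠ 0 := (Real.sqrt_pos.2 hax).ne'
      have hIH : ∀ i j, ∑ l, Θ x l i * Θ x l j =
          W x i.succ j.succ - W x 0 i.succ * W x 0 j.succ / W x 0 0 := by
        intro i j
        have := congrFun (congrFun (hΘW x hx) i) j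
        simpa [mul_apply] using this
      ext i j
      rw [mul_apply]
      simp only [transpose_apply, of_apply, Fin.sum_univ_succ]
      refine Fin.cases ?_ (fun i => ?_) i
      · refine Fin.cases ?_ (fun j => ?_) j
        · simpa using hss
        · simpa using mul_div_cancel₀ (W x 0 j.succ) hs0
      · refine Fin.cases ?_ (fun j => ?_) j
        · simpa [(hsymm x hx).apply 0 i.succ] using div_mul_cancel₀ (W x 0 i.succ) hs0
        · simp only [Fin.cons_zero, Fin.cons_succ, hIH]
          rw [div_mul_div_comm, hss]
          ring

/-! ### Eigenvalues of the symmetric part -/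

theorem dotProduct_symPart_mulVec {n : ℕ} (F : Matrix (Fin n) (Fin n) ℝ) (y : Fin n → ℝ) :
    y ⬝ᵥ (symPart F *ᵥ y) = y ⬝ᵥ (F *ᵥ y) := by
  have h : y ⬝ᵥ (Fᵀ *ᵥ y) = y ⬝ᵥ (F *ᵥ y) := by
    rw [mulVec_transpose, dotProduct_comm, ← dotProduct_mulVec]
  rw [symPart, smul_mulVec, add_mulVec, dotProduct_smul, dotProduct_add, h, smul_eq_mul]
  ring

/-- A negative semidefinite form with a nontrivial isotropic vector has largest eigenvalue `0`;
if moreover it is at most `-c` on a hyperplane, the second eigenvalue is at most `-c`, since any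
plane meets a hyperplane. -/
theorem symEigenvalue_of_form {n : ℕ} (hn₀ : 0 < n) (hn₁ : 1 < n)
    {F : Matrix (Fin n) (Fin n) ℝ} {c : ℝ} (hc : 0 < c) (hneg : ∀ y : Fin n → ℝ, y ⬝ᵥ (F *ᵥ y) ≤ 0) {y₀ : Fin n → ℝ} (hy₀ : y₀ ≠ 0)
    (hzero : y₀ ⬝ᵥ (F *ᵥ y₀) = 0) (l : (Fin n → ℝ) →ₗ[ℝ] ℝ)
    (hl : ∀ y, l y = 0 → y ⬝ᵥ (F *ᵥ y) ≤ -c * (y ⬝ᵥ y)) :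
    symEigenvalue F ⟨0, hn₀⟩ = 0 ∧ symEigenvalue F ⟨1, hn₁⟩ ≤ -c := by
  set T := toEuclideanLin (symPart F) with hTdef
  have hT : T.IsSymmetric := isSymmetric_toEuclideanLin_iff.2 (symPart_isHermitian F)
  set e := hT.eigenvectorBasis (finrank_euclideanSpace (𝕜 := ℝ) (ι := Fin n)) with he
  set μ : Fin (Fintype.card (Fin n)) → ℝ :=
    hT.eigenvalues (finrank_euclideanSpace (𝕜 := ℝ) (ι := Fin n)) with hμ
  have hTe : ∀ i, T (e i) = μ i • e i := fun i => hT.apply_eigenvectorBasis _ i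
  have hanti : Antitone μ := hT.eigenvalues_antitone _
  have hform : ∀ v : EuclideanSpace ℝ (Fin n), inner ℝ v (T v) = v.ofLp ⬝ᵥ (F *ᵥ v.ofLp) := by
    intro v
    rw [← dotProduct_symPart_mulVec, EuclideanSpace.inner_eq_star_dotProduct, dotProduct_comm]
    simp [hTdef, toLpLin_apply]
  have hnorm : ∀ v : EuclideanSpace ℝ (Fin n), inner ℝ v v = v.ofLp ⬝ᵥ v.ofLp := by
    intro v
    rw [EuclideanSpace.inner_eq_star_dotProduct]
    simp
  have hsum : ∀ v, inner ℝ v (T v) = ∑ i, μ i * (inner ℝ (e i) v) ^ 2 := by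
    intro v
    rw [← e.sum_inner_mul_inner v (T v)]
    refine Finset.sum_congr rfl fun i _ => ?_
    rw [← hT (e i) v, hTe, real_inner_smul_left, real_inner_comm]
    ring
  have hle : ∀ i, μ i ≤ 0 := by
    intro i
    have h := hneg (e i).ofLp
    rw [← hform, hTe, real_inner_smul_right, real_inner_self_eq_norm_sq, e.norm_eq_one] at h
    simpa using h
  set i0 : Fin (Fintype.card (Fin n)) := Fin.cast (Fintype.card_fin n).symm ⟨0, hn₀⟩ with hi0
  set i1 : Fin (Fintype.card (Fin n)) := Fin.cast (Fintype.card_fin n).symm ⟨1, hn₁⟩ with hi1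
  have h01 : i0 ≠ i1 := by simp [hi0, hi1, Fin.ext_iff]
  have hmu0 : μ i0 = 0 := by
    refine le_antisymm (hle i0) (not_lt.1 fun hlt => ?_)
    set v : EuclideanSpace ℝ (Fin n) := WithLp.toLp 2 y₀ with hv
    have h1 : inner ℝ v (T v) = 0 := by rw [hform]; exact hzero
    have h2 : inner ℝ v (T v) ≤ μ i0 * ‖v‖ ^ 2 := by
      rw [hsum, ← e.sum_sq_inner_right v, Finset.mul_sum]
      refine Finset.sum_le_sum fun i _ => ?_
      exact mul_le_mul_of_nonneg_right (hanti (Fin.le_def.2 (by simp [hi0]))) (sq_nonneg _)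
    have h3 : v ≠ 0 := fun h => hy₀ (by simpa [hv] using h)
    have h4 : 0 < ‖v‖ ^ 2 := by positivity
    nlinarith
  refine ⟨hmu0, ?_⟩
  change μ i1 ≤ -c
  have hQ : ∀ p : ℝ, inner ℝ (e i1 + p • e i0) (T (e i1 + p • e i0)) = μ i1 := by
    intro p
    have hne : inner ℝ (e i0) (e i1) = 0 := e.inner_eq_zero h01
    have hne' : inner ℝ (e i1) (e i0) = 0 := e.inner_eq_zero h01.symm
    simp [map_add, hTe, hmu0, inner_add_left, inner_smul_left, inner_smul_right, hne, e.norm_eq_one]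
  have hN : ∀ p : ℝ, inner ℝ (e i1 + p • e i0) (e i1 + p • e i0) = 1 + p ^ 2 := by
    intro p
    have hne : inner ℝ (e i0) (e i1) = 0 := e.inner_eq_zero h01
    have hne' : inner ℝ (e i1) (e i0) = 0 := e.inner_eq_zero h01.symm
    simp only [inner_add_left, inner_add_right, real_inner_smul_left, real_inner_smul_right, hne,
      hne', real_inner_self_eq_norm_sq, norm_smul, mul_pow, Real.norm_eq_abs, sq_abs,
      e.norm_eq_one]
    ring
  have hl0 : l (e i0).ofLp ≠ 0 := by
    intro h0
    have h := hl _ h0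
    rw [← hform, ← hnorm, hTe, hmu0, zero_smul, inner_zero_right, real_inner_self_eq_norm_sq,
      e.norm_eq_one] at h
    linarith
  have h := hl (e i1 + (-(l (e i1).ofLp) / l (e i0).ofLp) • e i0).ofLp (by
    simp only [WithLp.ofLp_add, WithLp.ofLp_smul, map_add, map_smul, smul_eq_mul]
    field_simp
    ring)
  rw [← hform, ← hnorm, hQ, hN] at h
  nlinarith [sq_nonneg (-(l (e i1).ofLp) / l (e i0).ofLp)]

variable {n : ℕ}

/-! ### The transverse projection and its contraction -/

theorem _root_.HasDerivAt.dotProduct_mulVec {u v : ℝ → Fin n → ℝ}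
    {A : ℝ → Matrix (Fin n) (Fin n) ℝ} {u' v' : Fin n → ℝ} {A' : Matrix (Fin n) (Fin n) ℝ} {t : ℝ}
    (hu : HasDerivAt u u' t) (hA : ∀ i j, HasDerivAt (fun s => A s i j) (A' i j) t)
    (hv : HasDerivAt v v' t) :
    HasDerivAt (fun s => u s ⬝ᵥ (A s *ᵥ v s))
      (u' ⬝ᵥ (A t *ᵥ v t) + u t ⬝ᵥ (A' *ᵥ v t) + u t ⬝ᵥ (A t *ᵥ v')) t := by
  have h : HasDerivAt (fun s => ∑ i, u s i * ∑ j, A s i j * v s j)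
      (∑ i, (u' i * ∑ j, A t i j * v t j + u t i * ∑ j, (A' i j * v t j + A t i j * v' j))) t :=
    HasDerivAt.fun_sum fun i _ => (hasDerivAt_pi.1 hu i).mul
      (HasDerivAt.fun_sum fun j _ => (hA i j).mul (hasDerivAt_pi.1 hv j))
  convert! h using 1
  simp only [dotProduct, mulVec, ← Finset.sum_add_distrib]
  refine Finset.sum_congr rfl fun i _ => ?_
  rw [Finset.sum_add_distrib]
  ring

theorem dotProduct_mulVec_comm_of_isSymm {A : Matrix (Fin n) (Fin n) ℝ} (hA : A.IsSymm)
    (u v : Fin n → ℝ) : u ⬝ᵥ (A *ᵥ v) = v ⬝ᵥ (A *ᵥ u) := by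
  rw [dotProduct_mulVec, ← mulVec_transpose, hA.eq, dotProduct_comm]

theorem abs_dotProduct_mulVec_le (A : Matrix (Fin n) (Fin n) ℝ) (v : Fin n → ℝ) :
    |v ⬝ᵥ (A *ᵥ v)| ≤ (∑ i, ∑ j, |A i j|) * ‖v‖ ^ 2 := by
  simp only [dotProduct, mulVec, Finset.mul_sum, Finset.sum_mul]
  refine (Finset.abs_sum_le_sum_abs _ _).trans (Finset.sum_le_sum fun i _ =>
    (Finset.abs_sum_le_sum_abs _ _).trans (Finset.sum_le_sum fun j _ => ?_))
  rw [abs_mul, abs_mul]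
  have hi : |v i| ≤ ‖v‖ := norm_le_pi_norm v i
  have hj : |v j| ≤ ‖v‖ := norm_le_pi_norm v j
  calc |v i| * (|A i j| * |v j|) ≤ ‖v‖ * (|A i j| * ‖v‖) := by gcongr
    _ = |A i j| * ‖v‖ ^ 2 := by ring

theorem norm_sq_le_dotProduct (v : Fin n → ℝ) : ‖v‖ ^ 2 ≤ v ⬝ᵥ v := by
  have h0 : 0 ≤ v ⬝ᵥ v := Finset.sum_nonneg fun i _ => mul_self_nonneg _
  have h : ‖v‖ ≤ √(v ⬝ᵥ v) := (pi_norm_le_iff_of_nonneg (Real.sqrt_nonneg _)).2 fun i => by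
    rw [Real.norm_eq_abs]
    refine Real.abs_le_sqrt ?_
    rw [sq]
    exact Finset.single_le_sum (f := fun i => v i * v i) (fun i _ => mul_self_nonneg _)
      (Finset.mem_univ i)
  calc ‖v‖ ^ 2 ≤ √(v ⬝ᵥ v) ^ 2 := by gcongr
    _ = v ⬝ᵥ v := Real.sq_sqrt h0

section Dynamics

variable {k : WithTop ℕ∞} {F : (Fin n → ℝ) → (Fin n → ℝ)} {φ : ℝ → (Fin n → ℝ) → (Fin n → ℝ)}
  {K : Set (Fin n → ℝ)} {M : (Fin n → ℝ) → Matrix (Fin n) (Fin n) ℝ} {lam : ℝ}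

/-- The covector field that takes the value `1` on the vector field `F` and whose kernel is the
`M`-orthogonal complement of `F`. -/
noncomputable def transverseForm (F : (Fin n → ℝ) → (Fin n → ℝ))
    (M : (Fin n → ℝ) → Matrix (Fin n) (Fin n) ℝ) (x : Fin n → ℝ) : (Fin n → ℝ) →L[ℝ] ℝ :=
  LinearMap.toContinuousLinearMap
    { toFun := fun v => (F x ⬝ᵥ (M x *ᵥ v)) / (F x ⬝ᵥ (M x *ᵥ F x))
      map_add' := fun u v => by rw [mulVec_add, dotProduct_add, add_div]
      map_smul' := fun c v => by
        rw [mulVec_smul, dotProduct_smul, smul_eq_mul, mul_div_assoc]; rfl }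

theorem transverseForm_apply (x v : Fin n → ℝ) :
    transverseForm F M x v = (F x ⬝ᵥ (M x *ᵥ v)) / (F x ⬝ᵥ (M x *ᵥ F x)) := rfl

/-- The `M`-orthogonal projection along the vector field `F`. -/
noncomputable def transverseProj (F : (Fin n → ℝ) → (Fin n → ℝ))
    (M : (Fin n → ℝ) → Matrix (Fin n) (Fin n) ℝ) (x : Fin n → ℝ) :
    (Fin n → ℝ) →L[ℝ] (Fin n → ℝ) :=
  ContinuousLinearMap.id ℝ _ - (transverseForm F M x).smulRight (F x)

theorem transverseProj_apply (x v : Fin n → ℝ) :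
    transverseProj F M x v = v - transverseForm F M x v • F x := rfl

theorem UniformlyPosDefOn.pos (hM : UniformlyPosDefOn M K) {x : Fin n → ℝ} (hx : x ∈ K)
    {v : Fin n → ℝ} (hv : v ≠ 0) : 0 < v ⬝ᵥ (M x *ᵥ v) := by
  obtain ⟨a, ha, h⟩ := hM.2
  refine lt_of_lt_of_le (mul_pos ha ?_) (h x hx v)
  exact lt_of_lt_of_le (by positivity) (norm_sq_le_dotProduct v)

theorem transverseForm_self (hM : UniformlyPosDefOn M K) (hne : ∀ x ∈ K, F x ≠ 0)
    {x : Fin n → ℝ} (hx : x ∈ K) : transverseForm F M x (F x) = 1 :=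
  div_self (hM.pos hx (hne x hx)).ne'

/-- A covector that kills `F x` does not see the component along `F x`. -/
theorem apply_transverseProj_of_apply_eq_zero {x : Fin n → ℝ} {w : (Fin n → ℝ) →L[ℝ] ℝ}
    (hw : w (F x) = 0) : w.comp (transverseProj F M x) = w := by
  ext v
  simp [transverseProj_apply, hw]

theorem dotProduct_mulVec_transverseProj (hM : UniformlyPosDefOn M K) (hne : ∀ x ∈ K, F x ≠ 0)
    {x : Fin n → ℝ} (hx : x ∈ K) (v : Fin n → ℝ) :
    F x ⬝ᵥ (M x *ᵥ transverseProj F M x v) = 0 := by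
  have h := (hM.pos hx (hne x hx)).ne'
  rw [transverseProj_apply, mulVec_sub, mulVec_smul, dotProduct_sub, dotProduct_smul,
    transverseForm_apply, smul_eq_mul, div_mul_cancel₀ _ h, sub_self]

/-- The transverse form is smooth near `K`. -/
theorem exists_contDiffOn_transverseForm (hF : ContDiff ℝ k F) (hsm : SmoothOn k M K)
    (hM : UniformlyPosDefOn M K) (hne : ∀ x ∈ K, F x ≠ 0) :
    ∃ U : Set (Fin n → ℝ), IsOpen U ∧ K ⊆ U ∧ ContDiffOn ℝ k (transverseForm F M) U ∧
      ∀ i j, ContDiffOn ℝ k (fun x => M x i j) U := by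
  obtain ⟨U, hU, hKU, hMU⟩ := hsm
  have hFi : ∀ i, ContDiff ℝ k fun x => F x i := contDiff_pi.1 hF
  have hq : ∀ w : (Fin n → ℝ) → (Fin n → ℝ), ContDiff ℝ k w →
      ContDiffOn ℝ k (fun x => F x ⬝ᵥ (M x *ᵥ w x)) U := by
    intro w hw
    simp only [dotProduct, mulVec]
    exact ContDiffOn.sum fun i _ => (hFi i).contDiffOn.mul
      (ContDiffOn.sum fun j _ => (hMU i j).mul (contDiff_pi.1 hw j).contDiffOn)
  refine ⟨U ∩ (fun x => F x ⬝ᵥ (M x *ᵥ F x)) ⁻¹' {0}ᶜ,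
    (hq F hF).continuousOn.isOpen_inter_preimage hU isOpen_compl_singleton,
    fun x hx => ⟨hKU hx, (hM.pos hx (hne x hx)).ne'⟩, ?_,
    fun i j => (hMU i j).mono inter_subset_left⟩
  refine contDiffOn_clm_apply.2 fun v => ?_
  exact ((hq (fun _ => v) contDiff_const).mono inter_subset_left).div
    ((hq F hF).mono inter_subset_left) fun x hx => hx.2

theorem contDiffOn_transverseProj {U : Set (Fin n → ℝ)} (hF : ContDiff ℝ k F)
    (hα : ContDiffOn ℝ k (transverseForm F M) U) : ContDiffOn ℝ k (transverseProj F M) U :=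
  contDiffOn_const.sub (hα.smulRight hF.contDiffOn)

theorem jacobian_mulVec (F : (Fin n → ℝ) → (Fin n → ℝ)) (x v : Fin n → ℝ) :
    jacobian F x *ᵥ v = fderiv ℝ F x v := by
  rw [jacobian, LinearMap.toMatrix'_mulVec]
  rfl

/-- A matrix field differentiated along the flow. -/
theorem IsFlow.hasDerivAt_matrix (hφ : IsFlow F φ) {A : (Fin n → ℝ) → Matrix (Fin n) (Fin n) ℝ}
    {x : Fin n → ℝ} {t : ℝ} (hA : ∀ i j, DifferentiableAt ℝ (fun y => A y i j) (φ t x))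
    (i j : Fin n) : HasDerivAt (fun s => A (φ s x) i j) (flowDeriv F A (φ t x) i j) t := by
  have h : HasFDerivAt (fun y => A y i j) (fderiv ℝ (fun y => A y i j) (φ t x)) (φ t x) :=
    (hA i j).hasFDerivAt
  exact h.comp_hasDerivAt (f := fun s => φ s x) t (hφ.hasDerivAt x t)

theorem dotProduct_mulVec_linearized {A D J : Matrix (Fin n) (Fin n) ℝ} (hA : A.IsSymm)
    {p f : Fin n → ℝ} (hpf : p ⬝ᵥ (A *ᵥ f) = 0) (c : ℝ) :
    (J *ᵥ p - c • f) ⬝ᵥ (A *ᵥ p) + p ⬝ᵥ (D *ᵥ p) + p ⬝ᵥ (A *ᵥ (J *ᵥ p - c • f)) =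
      p ⬝ᵥ ((D + Jᵀ * A + A * J) *ᵥ p) := by
  have h1 : p ⬝ᵥ (A *ᵥ (J *ᵥ p - c • f)) = p ⬝ᵥ ((A * J) *ᵥ p) := by
    rw [mulVec_sub, dotProduct_sub, mulVec_smul, dotProduct_smul, hpf, smul_zero, sub_zero,
      mulVec_mulVec]
  have h2 : p ⬝ᵥ ((Jᵀ * A) *ᵥ p) = p ⬝ᵥ ((A * J) *ᵥ p) := by
    rw [← mulVec_mulVec, ← mulVec_mulVec, dotProduct_mulVec_comm_of_isSymm hA p, mulVec_transpose,
      dotProduct_comm p, ← dotProduct_mulVec, dotProduct_comm]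
  rw [dotProduct_mulVec_comm_of_isSymm hA _ p, h1, add_mulVec, add_mulVec, dotProduct_add,
    dotProduct_add, h2]
  ring

/-- The component of a solution of the variational equation that is `M`-orthogonal to the vector
field decays in the metric `M`: the correction that keeps it orthogonal is parallel to the vector
field and does not contribute to the derivative of the energy. -/
theorem hasDerivAt_transverseEnergy (hk : 1 ≤ k) (hφ : IsFlow F φ) (hF : ContDiff ℝ k F)
    {L : NNReal} (hL : LipschitzWith L F) (hM : IsTransverseContractionMetric k F K M lam)
    (hne : ∀ x ∈ K, F x ≠ 0) {x : Fin n → ℝ} {t : ℝ} (hx : φ t x ∈ K) (v : Fin n → ℝ) :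
    ∃ E', HasDerivAt (fun s => transverseProj F M (φ s x) (fderiv ℝ (φ s) x v) ⬝ᵥ
        (M (φ s x) *ᵥ transverseProj F M (φ s x) (fderiv ℝ (φ s) x v))) E' t ∧
      E' ≤ -(2 * lam) * (transverseProj F M (φ t x) (fderiv ℝ (φ t) x v) ⬝ᵥ
        (M (φ t x) *ᵥ transverseProj F M (φ t x) (fderiv ℝ (φ t) x v))) := by
  have hF1 : ContDiff ℝ 1 F := hF.of_le hk
  have hk0 : k ≠ 0 := (lt_of_lt_of_le one_pos hk).ne'
  obtain ⟨U, hU, hKU, hα, hMU⟩ := exists_contDiffOn_transverseForm hF hM.smooth hM.posDef hne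
  have hUx := hU.mem_nhds (hKU hx)
  have hw := hφ.hasDerivAt_fderiv hF1 hL x v t
  have hα' : HasFDerivAt (transverseForm F M) (fderiv ℝ (transverseForm F M) (φ t x)) (φ t x) :=
    ((hα.differentiableOn hk0).differentiableAt hUx).hasFDerivAt
  have hF' : HasFDerivAt F (fderiv ℝ F (φ t x)) (φ t x) :=
    ((hF1.differentiable one_ne_zero) (φ t x)).hasFDerivAt
  have ha := (hα'.comp_hasDerivAt (f := fun s => φ s x) t (hφ.hasDerivAt x t)).clm_apply hw
  have hFt := hF'.comp_hasDerivAt (f := fun s => φ s x) t (hφ.hasDerivAt x t)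
  have hMt := hφ.hasDerivAt_matrix (A := M) (x := x) (t := t)
    fun i j => ((hMU i j).differentiableOn hk0).differentiableAt hUx
  have hsymm := hM.posDef.1 _ hx
  have horth := dotProduct_mulVec_transverseProj hM.posDef hne hx (fderiv ℝ (φ t) x v)
  have hcon := hM.contraction _ hx (transverseProj F M (φ t x) (fderiv ℝ (φ t) x v))
  -- the derivative of the projected solution, up to a multiple of the vector field
  obtain ⟨c, hp⟩ : ∃ c : ℝ, HasDerivAt
      (fun s => transverseProj F M (φ s x) (fderiv ℝ (φ s) x v))
      (jacobian F (φ t x) *ᵥ transverseProj F M (φ t x) (fderiv ℝ (φ t) x v) - c • F (φ t x)) t := by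
    refine ⟨fderiv ℝ (transverseForm F M) (φ t x) (F (φ t x)) (fderiv ℝ (φ t) x v) +
      transverseForm F M (φ t x) (fderiv ℝ F (φ t x) (fderiv ℝ (φ t) x v)),
      (hw.sub (ha.smul hFt)).congr_deriv ?_⟩
    rw [jacobian_mulVec, transverseProj_apply, map_sub, map_smul, sub_sub]
    rfl
  refine ⟨_, hp.dotProduct_mulVec hMt hp, ?_⟩
  generalize transverseProj F M (φ t x) (fderiv ℝ (φ t) x v) = p at *
  rw [dotProduct_mulVec_linearized hsymm
    ((dotProduct_mulVec_comm_of_isSymm hsymm _ _).trans horth)]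
  by_cases hp0 : p = 0
  · simp [hp0]
  · have h := hcon hp0 horth
    rw [add_mulVec, dotProduct_add, smul_mulVec, dotProduct_smul, smul_eq_mul] at h
    linarith

/-- Exponential decay of the differential of the flow transversally to the vector field. -/
theorem exists_norm_transverseProj_fderiv_le (hk : 1 ≤ k) (hφ : IsFlow F φ)
    (hF : ContDiff ℝ k F) {L : NNReal} (hL : LipschitzWith L F) (hK : IsCompact K)
    (hM : IsTransverseContractionMetric k F K M lam) (hne : ∀ x ∈ K, F x ≠ 0)
    (hinv : ∀ t, 0 ≤ t → MapsTo (φ t) K K) :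
    ∃ C : ℝ, 0 ≤ C ∧ ∀ x ∈ K, ∀ t, 0 ≤ t →
      ‖(transverseProj F M (φ t x)).comp (fderiv ℝ (φ t) x)‖ ≤ C * Real.exp (-lam * t) := by
  obtain ⟨U, hU, hKU, hα, hMU⟩ := exists_contDiffOn_transverseForm hF hM.smooth hM.posDef hne
  obtain ⟨a, ha, hMa⟩ := hM.posDef.2
  obtain ⟨c₁, hc₁⟩ := hK.exists_bound_of_continuousOn
    ((contDiffOn_transverseProj hF hα).continuousOn.mono hKU)
  obtain ⟨c₂, hc₂⟩ := hK.exists_bound_of_continuousOn (f := fun x => ∑ i, ∑ j, |M x i j|)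
    (continuousOn_finsetSum _ fun i _ => continuousOn_finsetSum _ fun j _ =>
      ((hMU i j).continuousOn.mono hKU).abs)
  refine ⟨√(|c₂| / a) * |c₁|, by positivity, fun x hx t ht => ?_⟩
  refine ContinuousLinearMap.opNorm_le_bound _ (by positivity) fun v => ?_
  set e : ℝ → ℝ := fun s => transverseProj F M (φ s x) (fderiv ℝ (φ s) x v) ⬝ᵥ
    (M (φ s x) *ᵥ transverseProj F M (φ s x) (fderiv ℝ (φ s) x v)) with he
  have hder : ∀ s, 0 ≤ s → ∃ E', HasDerivAt e E' s ∧ E' ≤ -(2 * lam) * e s := fun s hs =>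
    hasDerivAt_transverseEnergy hk hφ hF hL hM hne (hinv s hs hx) v
  have hanti : AntitoneOn (fun s => e s * Real.exp (2 * lam * s)) (Ici 0) := by
    have hd : ∀ s, 0 ≤ s → ∃ D, HasDerivAt (fun s => e s * Real.exp (2 * lam * s)) D s ∧
        D ≤ 0 := by
      intro s hs
      obtain ⟨E', hE', hle⟩ := hder s hs
      refine ⟨_, hE'.mul (((hasDerivAt_id s).const_mul (2 * lam)).exp), ?_⟩
      have := Real.exp_pos (2 * lam * s)
      simp only [id, mul_one]
      nlinarith
    refine antitoneOn_of_deriv_nonpos (convex_Ici 0) (fun s hs => ?_) (fun s hs => ?_)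
      fun s hs => ?_
    · obtain ⟨D, hD, _⟩ := hd s hs
      exact hD.continuousAt.continuousWithinAt
    · obtain ⟨D, hD, _⟩ := hd s (interior_subset hs)
      exact hD.differentiableAt.differentiableWithinAt
    · obtain ⟨D, hD, h0⟩ := hd s (interior_subset hs)
      rwa [hD.deriv]
  have h1 : e t * Real.exp (2 * lam * t) ≤ e 0 := by
    simpa using hanti self_mem_Ici ht ht
  have h2 : e 0 ≤ |c₂| * (|c₁| * ‖v‖) ^ 2 := by
    have h3 : e 0 = transverseProj F M x v ⬝ᵥ (M x *ᵥ transverseProj F M x v) := by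
      have : φ 0 = id := funext hφ.zero
      simp [he, this]
    rw [h3]
    refine (le_abs_self _).trans ((abs_dotProduct_mulVec_le _ _).trans ?_)
    have h4 : ‖transverseProj F M x v‖ ≤ |c₁| * ‖v‖ :=
      ContinuousLinearMap.le_of_opNorm_le _ ((hc₁ x hx).trans (le_abs_self _)) v
    have h5 : ∑ i, ∑ j, |M x i j| ≤ |c₂| :=
      (le_abs_self _).trans ((hc₂ x hx).trans (le_abs_self _))
    gcongr
  have h6 : a * ‖transverseProj F M (φ t x) (fderiv ℝ (φ t) x v)‖ ^ 2 ≤ e t :=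
    (mul_le_mul_of_nonneg_left (norm_sq_le_dotProduct _) ha.le).trans (hMa _ (hinv t ht hx) _)
  have hexp : Real.exp (-lam * t) ^ 2 * Real.exp (2 * lam * t) = 1 := by
    rw [← Real.exp_nat_mul, ← Real.exp_add]
    norm_num
    ring
  refine abs_le_of_sq_le_sq' ?_ (by positivity) |>.2
  have hsq : (√(|c₂| / a) * |c₁| * Real.exp (-lam * t) * ‖v‖) ^ 2 =
      (|c₂| * (|c₁| * ‖v‖) ^ 2) / a * Real.exp (-lam * t) ^ 2 := by
    rw [mul_pow, mul_pow, mul_pow, Real.sq_sqrt (by positivity)]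
    ring
  rw [hsq, div_mul_eq_mul_div, le_div_iff₀ ha]
  have hpos := Real.exp_pos (-lam * t)
  calc ‖transverseProj F M (φ t x) (fderiv ℝ (φ t) x v)‖ ^ 2 * a ≤ e t := by linarith
    _ = e t * Real.exp (2 * lam * t) * Real.exp (-lam * t) ^ 2 := by
      rw [mul_assoc, mul_comm (Real.exp (2 * lam * t)), hexp, mul_one]
    _ ≤ _ := mul_le_mul_of_nonneg_right (h1.trans h2) (by positivity)

/-! ### The flow-invariant covector field -/

/-- The pullback of the transverse form by the time-`t` map of the flow. -/
noncomputable def pulledForm (F : (Fin n → ℝ) → (Fin n → ℝ))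
    (M : (Fin n → ℝ) → Matrix (Fin n) (Fin n) ℝ) (φ : ℝ → (Fin n → ℝ) → (Fin n → ℝ)) (t : ℝ)
    (x : Fin n → ℝ) : (Fin n → ℝ) →L[ℝ] ℝ :=
  (transverseForm F M (φ t x)).comp (fderiv ℝ (φ t) x)

theorem pulledForm_zero (hφ : IsFlow F φ) (x : Fin n → ℝ) :
    pulledForm F M φ 0 x = transverseForm F M x := by
  have : φ 0 = id := funext hφ.zero
  ext v
  simp [pulledForm, this]

theorem pulledForm_add (hφ : IsFlow F φ) (hF : ContDiff ℝ 1 F) {L : NNReal}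
    (hL : LipschitzWith L F) (s t : ℝ) (x : Fin n → ℝ) :
    pulledForm F M φ (s + t) x = (pulledForm F M φ s (φ t x)).comp (fderiv ℝ (φ t) x) := by
  rw [pulledForm, hφ.fderiv_add hF hL, hφ.add hL, pulledForm, ContinuousLinearMap.comp_assoc]

theorem pulledForm_apply_self (hφ : IsFlow F φ) (hF : ContDiff ℝ 1 F) {L : NNReal}
    (hL : LipschitzWith L F) (hM : UniformlyPosDefOn M K) (hne : ∀ x ∈ K, F x ≠ 0) {t : ℝ}
    {x : Fin n → ℝ} (hx : φ t x ∈ K) : pulledForm F M φ t x (F x) = 1 := by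
  rw [pulledForm, ContinuousLinearMap.comp_apply, hφ.fderiv_apply_self hF hL,
    transverseForm_self hM hne hx]

/-- The increment of the pulled back forms only sees the transverse part of the differential of
the flow. -/
theorem pulledForm_add_sub (hφ : IsFlow F φ) (hF : ContDiff ℝ 1 F) {L : NNReal}
    (hL : LipschitzWith L F) (hM : UniformlyPosDefOn M K) (hne : ∀ x ∈ K, F x ≠ 0)
    (hinv : ∀ t, 0 ≤ t → MapsTo (φ t) K K) {s t : ℝ} (hs : 0 ≤ s) (ht : 0 ≤ t)
    {x : Fin n → ℝ} (hx : x ∈ K) :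
    pulledForm F M φ (s + t) x - pulledForm F M φ t x =
      (pulledForm F M φ s (φ t x) - transverseForm F M (φ t x)).comp
        ((transverseProj F M (φ t x)).comp (fderiv ℝ (φ t) x)) := by
  have hy := hinv t ht hx
  rw [← ContinuousLinearMap.comp_assoc, apply_transverseProj_of_apply_eq_zero,
    pulledForm_add hφ hF hL, ContinuousLinearMap.sub_comp]
  · rfl
  · rw [_root_.sub_apply, transverseForm_self hM hne hy,
      pulledForm_apply_self hφ hF hL hM hne (hinv s hs hy), sub_self]

theorem continuousOn_pulledForm (hφ : IsFlow F φ) (hF : ContDiff ℝ 1 F) {L : NNReal}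
    (hL : LipschitzWith L F) (hα : ContinuousOn (transverseForm F M) K)
    (hinv : ∀ t, 0 ≤ t → MapsTo (φ t) K K) {s : ℝ} (hs : 0 ≤ s) :
    ContinuousOn (pulledForm F M φ s) K := by
  have hφs := hφ.contDiff (m := 1) le_rfl hF hL s
  exact (hα.comp hφs.continuous.continuousOn (hinv s hs)).clm_comp
    (hφs.continuous_fderiv one_ne_zero).continuousOn

/-- The hypotheses on the flow of a transversally contracting vector field on a compact forward
invariant set, together with the exponential estimate they imply. -/
structure IsTransverselyDecaying (F : (Fin n → ℝ) → (Fin n → ℝ))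
    (φ : ℝ → (Fin n → ℝ) → (Fin n → ℝ)) (K : Set (Fin n → ℝ))
    (M : (Fin n → ℝ) → Matrix (Fin n) (Fin n) ℝ) (L : NNReal) (lam C : ℝ) : Prop where
  isFlow : IsFlow F φ
  contDiff : ContDiff ℝ 1 F
  lipschitz : LipschitzWith L F
  compact : IsCompact K
  posDef : UniformlyPosDefOn M K
  ne_zero : ∀ x ∈ K, F x ≠ 0
  mapsTo : ∀ t, 0 ≤ t → MapsTo (φ t) K K
  continuousOn_form : ContinuousOn (transverseForm F M) K
  rate_pos : 0 < lam
  const_nonneg : 0 ≤ C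
  decay : ∀ x ∈ K, ∀ t, 0 ≤ t →
    ‖(transverseProj F M (φ t x)).comp (fderiv ℝ (φ t) x)‖ ≤ C * Real.exp (-lam * t)

namespace IsTransverselyDecaying

variable {L : NNReal} {C : ℝ}

theorem exists_norm_add_sub_le (h : IsTransverselyDecaying F φ K M L lam C) {s : ℝ}
    (hs : 0 ≤ s) : ∃ B, 0 ≤ B ∧ ∀ x ∈ K, ∀ t, 0 ≤ t →
      ‖pulledForm F M φ (s + t) x - pulledForm F M φ t x‖ ≤ B * Real.exp (-lam * t) := by
  obtain ⟨c, hc⟩ := h.compact.exists_bound_of_continuousOn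
    ((continuousOn_pulledForm h.isFlow h.contDiff h.lipschitz h.continuousOn_form h.mapsTo hs).sub
      h.continuousOn_form)
  refine ⟨|c| * C, mul_nonneg (abs_nonneg _) h.const_nonneg, fun x hx t ht => ?_⟩
  rw [pulledForm_add_sub h.isFlow h.contDiff h.lipschitz h.posDef h.ne_zero h.mapsTo hs ht hx]
  refine (ContinuousLinearMap.opNorm_comp_le _ _).trans ?_
  rw [mul_assoc]
  exact mul_le_mul ((hc _ (h.mapsTo t ht hx)).trans (le_abs_self c)) (h.decay x hx t ht)
    (norm_nonneg _) (abs_nonneg _)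

theorem exp_neg_mul_natCast (lam : ℝ) (m : ℕ) : Real.exp (-lam * m) = Real.exp (-lam) ^ m := by
  rw [← Real.exp_nat_mul, mul_comm]

theorem exp_lt_one (h : IsTransverselyDecaying F φ K M L lam C) : Real.exp (-lam) < 1 :=
  Real.exp_lt_one_iff.2 (by linarith [h.rate_pos])

/-- The pullbacks of the transverse form converge as time tends to infinity, uniformly on `K`. -/
theorem exists_limit (h : IsTransverselyDecaying F φ K M L lam C) :
    ∃ (β : (Fin n → ℝ) → (Fin n → ℝ) →L[ℝ] ℝ) (B : ℝ), ∀ x ∈ K,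
      Tendsto (fun m : ℕ => pulledForm F M φ m x) atTop (𝓝 (β x)) ∧
      ∀ m : ℕ, ‖pulledForm F M φ m x - β x‖ ≤ B := by
  obtain ⟨B, hB0, hB⟩ := h.exists_norm_add_sub_le zero_le_one
  have hr := h.exp_lt_one
  have hdist : ∀ x ∈ K, ∀ m : ℕ,
      dist (pulledForm F M φ m x) (pulledForm F M φ (m + 1 : ℕ) x) ≤ B * Real.exp (-lam) ^ m := by
    intro x hx m
    rw [dist_comm, dist_eq_norm, ← exp_neg_mul_natCast]
    have := hB x hx m m.cast_nonneg
    rwa [add_comm (1 : ℝ), ← Nat.cast_succ] at this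
  have hlim : ∀ x, ∃ y, x ∈ K → Tendsto (fun m : ℕ => pulledForm F M φ m x) atTop (𝓝 y) := by
    intro x
    by_cases hx : x ∈ K
    · obtain ⟨y, hy⟩ := cauchySeq_tendsto_of_complete
        (cauchySeq_of_le_geometric (Real.exp (-lam)) B hr (hdist x hx))
      exact ⟨y, fun _ => hy⟩
    · exact ⟨0, fun hx' => absurd hx' hx⟩
  choose β hβ using hlim
  refine ⟨β, B / (1 - Real.exp (-lam)), fun x hx => ⟨hβ x hx, fun m => ?_⟩⟩
  rw [← dist_eq_norm]
  refine (dist_le_of_le_geometric_of_tendsto _ _ hr (hdist x hx) (hβ x hx) m).trans ?_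
  have h1 : 0 < 1 - Real.exp (-lam) := by linarith
  gcongr
  exact mul_le_of_le_one_right hB0 (pow_le_one₀ (Real.exp_pos _).le hr.le)

variable {β : (Fin n → ℝ) → (Fin n → ℝ) →L[ℝ] ℝ} {B : ℝ}

theorem limit_apply_self (h : IsTransverselyDecaying F φ K M L lam C) {x : Fin n → ℝ} (hx : x ∈ K)
    (hβ : Tendsto (fun m : ℕ => pulledForm F M φ m x) atTop (𝓝 (β x))) : β x (F x) = 1 := by
  have h1 : Tendsto (fun m : ℕ => pulledForm F M φ m x (F x)) atTop (𝓝 (β x (F x))) :=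
    ((ContinuousLinearMap.apply ℝ ℝ (F x)).continuous.tendsto _).comp hβ
  refine tendsto_nhds_unique h1 (tendsto_const_nhds.congr fun m => ?_)
  exact (pulledForm_apply_self h.isFlow h.contDiff h.lipschitz h.posDef h.ne_zero
    (h.mapsTo _ m.cast_nonneg hx)).symm

/-- The limit form is invariant under the flow. -/
theorem limit_comp_fderiv (h : IsTransverselyDecaying F φ K M L lam C)
    (hβ : ∀ x ∈ K, Tendsto (fun m : ℕ => pulledForm F M φ m x) atTop (𝓝 (β x)))
    {x : Fin n → ℝ} (hx : x ∈ K) {s : ℝ} (hs : 0 ≤ s) :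
    (β (φ s x)).comp (fderiv ℝ (φ s) x) = β x := by
  obtain ⟨B, hB0, hB⟩ := h.exists_norm_add_sub_le hs
  have h1 : Tendsto (fun m : ℕ => pulledForm F M φ (s + m) x) atTop
      (𝓝 ((β (φ s x)).comp (fderiv ℝ (φ s) x))) := by
    have h2 := (((ContinuousLinearMap.compL ℝ (Fin n → ℝ) (Fin n → ℝ) ℝ).flip
      (fderiv ℝ (φ s) x)).continuous.tendsto _).comp (hβ _ (h.mapsTo s hs hx))
    refine h2.congr fun m => ?_
    rw [add_comm, pulledForm_add h.isFlow h.contDiff h.lipschitz]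
    rfl
  have h3 : Tendsto (fun m : ℕ => pulledForm F M φ (s + m) x - pulledForm F M φ m x) atTop
      (𝓝 0) := by
    refine squeeze_zero_norm (fun m => hB x hx m m.cast_nonneg) ?_
    simp_rw [exp_neg_mul_natCast]
    simpa using (tendsto_pow_atTop_nhds_zero_of_lt_one (Real.exp_pos _).le
      h.exp_lt_one).const_mul B
  have h4 := h3.add (hβ x hx)
  simp only [sub_add_cancel, zero_add] at h4
  exact tendsto_nhds_unique h1 h4

/-- The differential of the flow is bounded uniformly in time. -/
theorem exists_norm_fderiv_le (h : IsTransverselyDecaying F φ K M L lam C)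
    (hB : ∀ x ∈ K, ∀ m : ℕ, ‖pulledForm F M φ m x - β x‖ ≤ B) :
    ∃ G, 1 ≤ G ∧ ∀ x ∈ K, ∀ m : ℕ, ‖fderiv ℝ (φ m) x‖ ≤ G := by
  obtain ⟨c₁, hc₁⟩ := h.compact.exists_bound_of_continuousOn h.contDiff.continuous.continuousOn
  obtain ⟨c₂, hc₂⟩ := h.compact.exists_bound_of_continuousOn h.continuousOn_form
  refine ⟨max 1 (C + (|B| + (|B| + |c₂|)) * |c₁|), le_max_left _ _, fun x hx m =>
    le_trans ?_ (le_max_right _ _)⟩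
  have hsplit : fderiv ℝ (φ m) x = (transverseProj F M (φ m x)).comp (fderiv ℝ (φ m) x) +
      (pulledForm F M φ m x).smulRight (F (φ m x)) := by
    ext1 v
    simp [transverseProj_apply, pulledForm]
  have h1 : ‖(transverseProj F M (φ m x)).comp (fderiv ℝ (φ m) x)‖ ≤ C := by
    refine (h.decay x hx m m.cast_nonneg).trans (mul_le_of_le_one_right h.const_nonneg ?_)
    rw [exp_neg_mul_natCast]
    exact pow_le_one₀ (Real.exp_pos _).le h.exp_lt_one.le
  have h2 : ‖pulledForm F M φ m x‖ ≤ |B| + (|B| + |c₂|) := by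
    have e : pulledForm F M φ m x = (pulledForm F M φ m x - β x) -
        (pulledForm F M φ (0 : ℕ) x - β x) + transverseForm F M x := by
      rw [Nat.cast_zero, pulledForm_zero h.isFlow]
      abel
    rw [e]
    refine (norm_add_le _ _).trans (((add_le_add_left (norm_sub_le _ _) _)).trans ?_)
    have e1 := (hB x hx m).trans (le_abs_self B)
    have e2 := (hB x hx 0).trans (le_abs_self B)
    have e3 := (hc₂ x hx).trans (le_abs_self c₂)
    linarith
  rw [hsplit]
  refine (norm_add_le _ _).trans (add_le_add h1 ?_)
  rw [ContinuousLinearMap.norm_smulRight_apply]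
  have h3 := (hc₁ _ (h.mapsTo m m.cast_nonneg hx)).trans (le_abs_self c₁)
  gcongr

/-- The limit form is of class `C^k` in the interior of `K`. For a given finite order, a large time
`N` makes the contraction of `φ N` on covectors that kill the vector field beat the bound on its
differential, so that the cohomological equation over `φ N` has a smooth solution. -/
theorem contDiffOn_limit_nat {k : ℕ} (h : IsTransverselyDecaying F φ K M L lam C)
    (hF : ContDiff ℝ (k + 1 : ℕ) F)
    (hint : ∀ t, 0 < t → MapsTo (φ t) K (interior K)) {U : Set (Fin n → ℝ)} (hU : IsOpen U)
    (hKU : K ⊆ U) (hα : ContDiffOn ℝ k (transverseForm F M) U)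
    (hβ : ∀ x ∈ K, Tendsto (fun m : ℕ => pulledForm F M φ m x) atTop (𝓝 (β x)))
    (hB : ∀ x ∈ K, ∀ m : ℕ, ‖pulledForm F M φ m x - β x‖ ≤ B) :
    ContDiffOn ℝ k β (interior K) := by
  obtain ⟨G, hG, hGm⟩ := h.exists_norm_fderiv_le hB
  have hkk : ((k : ℕ) : WithTop ℕ∞) ≤ ((k + 1 : ℕ) : WithTop ℕ∞) := by
    exact_mod_cast Nat.le_succ k
  obtain ⟨N, hN, hqN⟩ : ∃ N : ℕ, 1 ≤ N ∧ C * Real.exp (-lam) ^ N * G ^ k < 1 := by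
    have h0 : Tendsto (fun N : ℕ => C * Real.exp (-lam) ^ N * G ^ k) atTop (𝓝 0) := by
      simpa using ((tendsto_pow_atTop_nhds_zero_of_lt_one (Real.exp_pos (-lam)).le
        h.exp_lt_one).const_mul C).mul_const (G ^ k)
    exact ((eventually_ge_atTop 1).and (h0.eventually (gt_mem_nhds one_pos))).exists
  have hN0 : (0 : ℝ) ≤ N := N.cast_nonneg
  have hNpos : (0 : ℝ) < N := by exact_mod_cast hN
  have hgK := h.mapsTo N hN0
  have hg1 : ContDiff ℝ ((k + 1 : ℕ∞) : WithTop ℕ∞) (φ N) := h.isFlow.contDiff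
    (by exact_mod_cast Nat.le_add_left 1 k) (by exact_mod_cast hF) h.lipschitz N
  have hg0 : ContDiff ℝ k (φ N) := hg1.of_le (by exact_mod_cast Nat.le_succ k)
  have hg' : ContDiff ℝ k (fderiv ℝ (φ N)) := hg1.fderiv_right (by norm_cast)
  set V := U ∩ φ N ⁻¹' U with hV
  have hVo : IsOpen V := hU.inter (hU.preimage hg0.continuous)
  have hKV : K ⊆ V := fun x hx => ⟨hKU hx, hKU (hgK hx)⟩
  have hαg : ContDiffOn ℝ k (fun x => transverseForm F M (φ N x)) V :=
    hα.comp hg0.contDiffOn fun x hx => hx.2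
  have hPg : ContDiffOn ℝ k (fun x => transverseProj F M (φ N x)) V :=
    (contDiffOn_transverseProj (hF.of_le hkk) hα).comp hg0.contDiffOn fun x hx => hx.2
  set η : (Fin n → ℝ) → (Fin n → ℝ) →L[ℝ] ℝ := fun x =>
    pulledForm F M φ N x - transverseForm F M x with hηdef
  set A : (Fin n → ℝ) → ((Fin n → ℝ) →L[ℝ] ℝ) →L[ℝ] ((Fin n → ℝ) →L[ℝ] ℝ) := fun x =>
    (ContinuousLinearMap.compL ℝ (Fin n → ℝ) (Fin n → ℝ) ℝ).flip
      ((transverseProj F M (φ N x)).comp (fderiv ℝ (φ N) x)) with hAdef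
  have hη : ContDiffOn ℝ k η V :=
    (hαg.clm_comp hg'.contDiffOn).sub (hα.mono inter_subset_left)
  have hA : ContDiffOn ℝ k A V := by
    have hc : ContDiff ℝ k fun T : (Fin n → ℝ) →L[ℝ] (Fin n → ℝ) =>
        (ContinuousLinearMap.compL ℝ (Fin n → ℝ) (Fin n → ℝ) ℝ).flip T := by fun_prop
    exact hc.comp_contDiffOn (hPg.clm_comp hg'.contDiffOn)
  have hAq : ∀ x ∈ K, ‖A x‖ ≤ C * Real.exp (-lam) ^ N := by
    intro x hx
    have hq := h.decay x hx N hN0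
    rw [exp_neg_mul_natCast] at hq
    refine ContinuousLinearMap.opNorm_le_bound _ ((norm_nonneg _).trans hq) fun w => ?_
    refine (ContinuousLinearMap.opNorm_comp_le w _).trans ?_
    rw [mul_comm]
    gcongr
  have hq0 : 0 ≤ C * Real.exp (-lam) ^ N := mul_nonneg h.const_nonneg (by positivity)
  obtain ⟨u, hu, huk⟩ := exists_contDiffOn_cohomological h.compact hVo isOpen_interior hKV
    interior_subset (hint N hNpos) hG (fun x hx => hGm x hx N) k hg0.contDiffOn hη hA hq0 hAq hqN
  have hq1 : C * Real.exp (-lam) ^ N < 1 :=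
    lt_of_le_of_lt (le_mul_of_one_le_right hq0 (one_le_pow₀ hG)) hqN
  -- `β - α` is the bounded solution of the cohomological equation
  have hsol : ∀ x ∈ K, β x - transverseForm F M x =
      η x + A x (β (φ N x) - transverseForm F M (φ N x)) := by
    intro x hx
    have hz : (β (φ N x) - transverseForm F M (φ N x)) (F (φ N x)) = 0 := by
      rw [_root_.sub_apply, transverseForm_self h.posDef h.ne_zero (hgK hx),
        h.limit_apply_self (hgK hx) (hβ _ (hgK hx)), sub_self]
    have hAx : A x (β (φ N x) - transverseForm F M (φ N x)) = β x - pulledForm F M φ N x := by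
      change (β (φ N x) - transverseForm F M (φ N x)).comp
        ((transverseProj F M (φ N x)).comp (fderiv ℝ (φ N) x)) = _
      rw [← ContinuousLinearMap.comp_assoc, apply_transverseProj_of_apply_eq_zero hz,
        ContinuousLinearMap.sub_comp, h.limit_comp_fderiv hβ hx hN0]
      rfl
    rw [hAx]
    simp only [hηdef]
    abel
  have hbdd : ∀ x ∈ K, ‖β x - transverseForm F M x‖ ≤ B := by
    intro x hx
    have := hB x hx 0
    rwa [Nat.cast_zero, pulledForm_zero h.isFlow, norm_sub_rev] at this
  have heq : ∀ x ∈ interior K, β x = u x + transverseForm F M x := by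
    intro x hx
    have := tendsto_nhds_unique (hu.tendsto_at (interior_subset hx))
      (tendsto_cohomIter_of_eq hgK hAq hq0 hq1 hbdd hsol (interior_subset hx))
    rw [this, sub_add_cancel]
  exact (huk.add (hα.mono (interior_subset.trans hKU))).congr heq

end IsTransverselyDecaying

/-- A transverse contraction region without equilibria carries, near `K`, a covector field `β` of
class `C^k` that is invariant under the flow and takes the value `1` on the vector field: the
differential of the asymptotic phase. -/
theorem exists_invariantForm {k : ℕ∞} (hk : 1 ≤ k) (hφ : IsFlow F φ)
    (hF : ContDiff ℝ ((k + 1 : ℕ∞) : WithTop ℕ∞) F) {L : NNReal} (hL : LipschitzWith L F)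
    (hK : IsCompact K) (hlam : 0 < lam) (hM : IsTransverseContractionMetric k F K M lam)
    (hne : ∀ x ∈ K, F x ≠ 0) (hinv : ∀ t, 0 ≤ t → MapsTo (φ t) K K)
    (hint : ∀ t, 0 < t → MapsTo (φ t) K (interior K)) :
    ∃ (β : (Fin n → ℝ) → (Fin n → ℝ) →L[ℝ] ℝ) (V : Set (Fin n → ℝ)), IsOpen V ∧ K ⊆ V ∧
      ContDiffOn ℝ k β V ∧ (∀ x ∈ K, β x (F x) = 1) ∧
      ∀ x ∈ K, ∀ t, 0 ≤ t → (β (φ t x)).comp (fderiv ℝ (φ t) x) = β x := by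
  have hk1 : (1 : WithTop ℕ∞) ≤ k := by exact_mod_cast hk
  have hkk : (k : WithTop ℕ∞) ≤ ((k + 1 : ℕ∞) : WithTop ℕ∞) := by exact_mod_cast le_self_add
  have hFk : ContDiff ℝ k F := hF.of_le hkk
  have hF1 : ContDiff ℝ 1 F := hFk.of_le hk1
  obtain ⟨U, hU, hKU, hα, -⟩ := exists_contDiffOn_transverseForm hFk hM.smooth hM.posDef hne
  obtain ⟨C, hC, hdecay⟩ := exists_norm_transverseProj_fderiv_le hk1 hφ hFk hL hK hM hne hinv
  have h : IsTransverselyDecaying F φ K M L lam C :=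
    ⟨hφ, hF1, hL, hK, hM.posDef, hne, hinv, hα.continuousOn.mono hKU, hlam, hC, hdecay⟩
  obtain ⟨β, B, hβB⟩ := h.exists_limit
  have hβ := fun x hx => (hβB x hx).1
  have hB := fun x hx => (hβB x hx).2
  have hsmooth : ContDiffOn ℝ k β (interior K) := by
    refine contDiffOn_iff_forall_nat_le.2 fun m hm => ?_
    have hmF : ((m + 1 : ℕ) : ℕ∞) ≤ k + 1 := by
      push_cast
      gcongr
    exact h.contDiffOn_limit_nat (hF.of_le (by exact_mod_cast hmF)) hint hU hKU
      (hα.of_le (by exact_mod_cast hm)) hβ hB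
  -- the time-one map extends the form beyond `K`
  have hφ1 : ContDiff ℝ ((k + 1 : ℕ∞) : WithTop ℕ∞) (φ 1) :=
    hφ.contDiff (le_trans hk le_self_add) hF hL 1
  have hinvK : ∀ x ∈ K, ∀ t, 0 ≤ t → (β (φ t x)).comp (fderiv ℝ (φ t) x) = β x :=
    fun x hx t ht => h.limit_comp_fderiv hβ hx ht
  refine ⟨fun x => (β (φ 1 x)).comp (fderiv ℝ (φ 1) x), φ 1 ⁻¹' interior K,
    isOpen_interior.preimage hφ1.continuous, hint 1 one_pos, ?_, ?_, ?_⟩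
  · exact (hsmooth.comp (hφ1.of_le hkk).contDiffOn fun x hx => hx).clm_comp
      (hφ1.fderiv_right (by norm_cast)).contDiffOn
  · intro x hx
    beta_reduce
    rw [hinvK x hx 1 zero_le_one]
    exact h.limit_apply_self hx (hβ x hx)
  · intro x hx t ht
    beta_reduce
    rw [hinvK x hx 1 zero_le_one, hinvK _ (hinv t ht hx) 1 zero_le_one, hinvK x hx t ht]

end Dynamics

/-! ### Localisation of the vector field -/

/-- A vector field can be cut off away from a compact set. -/
theorem exists_cutoff {E : Type*} [NormedAddCommGroup E] [NormedSpace ℝ E] [FiniteDimensional ℝ E]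
    {m : ℕ∞} {f : E → E} (hf : ContDiff ℝ m f) {K : Set E} (hK : IsCompact K) :
    ∃ F : E → E, ContDiff ℝ m F ∧ HasCompactSupport F ∧ ∃ U, IsOpen U ∧ K ⊆ U ∧ EqOn F f U := by
  obtain ⟨R, hR, hKR⟩ := hK.isBounded.exists_pos_norm_lt
  let χ : ContDiffBump (0 : E) := ⟨R, R + 1, hR, by linarith⟩
  refine ⟨fun x => χ x • f x, χ.contDiff.smul hf, χ.hasCompactSupport.smul_right,
    Metric.ball 0 R, Metric.isOpen_ball, fun x hx => by simpa using hKR x hx, fun x hx => ?_⟩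
  simp only
  rw [χ.one_of_mem_closedBall (Metric.ball_subset_closedBall hx), one_smul]

theorem exists_lipschitz_bound_of_hasCompactSupport {E : Type*} [NormedAddCommGroup E]
    [NormedSpace ℝ E] {F : E → E} (hF : ContDiff ℝ 1 F) (hc : HasCompactSupport F) :
    ∃ L B : NNReal, LipschitzWith L F ∧ ∀ x, ‖F x‖ ≤ B := by
  obtain ⟨L, hL⟩ := hF.lipschitzWith_of_hasCompactSupport hc one_ne_zero
  obtain ⟨B, hB⟩ := hc.exists_bound_of_continuous hF.continuous
  exact ⟨L, B.toNNReal, hL, fun x => (hB x).trans (Real.le_coe_toNNReal B)⟩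

section Transfer

variable {f F : (Fin n → ℝ) → (Fin n → ℝ)} {φ : ℝ → (Fin n → ℝ) → (Fin n → ℝ)}
  {K U : Set (Fin n → ℝ)}

theorem jacobian_congr (hU : IsOpen U) (h : EqOn F f U) {x : Fin n → ℝ} (hx : x ∈ U) :
    jacobian F x = jacobian f x := by
  have : fderiv ℝ F x = fderiv ℝ f x := (h.eventuallyEq_of_mem (hU.mem_nhds hx)).fderiv_eq
  rw [jacobian, jacobian, this]

theorem flowDeriv_congr {x : Fin n → ℝ} (h : F x = f x)
    (A : (Fin n → ℝ) → Matrix (Fin n) (Fin n) ℝ) : flowDeriv F A x = flowDeriv f A x := by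
  rw [flowDeriv, flowDeriv, h]

theorem IsTransverseContractionMetric.congr {k : WithTop ℕ∞}
    {M : (Fin n → ℝ) → Matrix (Fin n) (Fin n) ℝ} {lam : ℝ}
    (hM : IsTransverseContractionMetric k f K M lam) (hU : IsOpen U) (hKU : K ⊆ U)
    (h : EqOn F f U) : IsTransverseContractionMetric k F K M lam where
  smooth := hM.smooth
  posDef := hM.posDef
  contraction x hx v hv hfv := by
    rw [h (hKU hx)] at hfv
    rw [flowDeriv_congr (h (hKU hx)), jacobian_congr hU h (hKU hx)]
    exact hM.contraction x hx v hv hfv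

/-- The orbits of a cut-off vector field that start in `K` never leave `K`, hence are orbits of the
original one. -/
theorem StrictlyForwardInvariant.mapsTo_flow (hinv : StrictlyForwardInvariant f K)
    (hK : IsClosed K) (hφ : IsFlow F φ) {L : NNReal} (hL : LipschitzWith L F) (hU : IsOpen U)
    (hKU : K ⊆ U) (h : EqOn F f U) :
    (∀ t, 0 ≤ t → MapsTo (φ t) K K) ∧ ∀ t, 0 < t → MapsTo (φ t) K (interior K) := by
  have hcont : ∀ x, Continuous fun t => φ t x := fun x =>
    continuous_iff_continuousAt.2 fun t => (hφ.hasDerivAt x t).continuousAt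
  have hcurve : ∀ x T, (∀ s ∈ Icc 0 T, φ s x ∈ U) →
      IsIntegralCurveOn (fun t => φ t x) (fun _ => f) (Icc 0 T) := by
    intro x T hs s hsT
    have h1 := hφ.hasDerivAt x s
    rw [h (hs s hsT)] at h1
    exact h1.hasDerivWithinAt
  have hstep : ∀ y ∈ K, ∃ ε > 0, ∀ t ∈ Ioc 0 ε, φ t y ∈ interior K := by
    intro y hy
    have hopen : IsOpen ((fun t => φ t y) ⁻¹' U) := hU.preimage (hcont y)
    have h0 : (0 : ℝ) ∈ (fun t => φ t y) ⁻¹' U := by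
      rw [mem_preimage, hφ.zero]
      exact hKU hy
    obtain ⟨ε, hε, hball⟩ := Metric.isOpen_iff.1 hopen 0 h0
    refine ⟨ε / 2, by positivity, hinv (fun t => φ t y) (ε / 2) (hcurve y _ fun s hs => ?_)
      (by rw [hφ.zero]; exact hy)⟩
    refine hball ?_
    rw [Metric.mem_ball, Real.dist_eq, sub_zero, abs_of_nonneg hs.1]
    linarith [hs.2]
  have hstay : ∀ t, 0 ≤ t → MapsTo (φ t) K K := by
    intro T hT x hx
    have hsub : Icc 0 T ⊆ {t | φ t x ∈ K} := by
      refine IsClosed.Icc_subset_of_forall_exists_gt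
        ((hK.preimage (hcont x)).inter isClosed_Icc) (by simpa [hφ.zero] using hx) ?_
      intro t ht y hy
      obtain ⟨ε, hε, hε'⟩ := hstep _ ht.1
      have hy' : 0 < y - t := sub_pos.2 hy
      have hmin : 0 < min ε (y - t) := lt_min hε hy'
      refine ⟨min ε (y - t) + t, ?_, by linarith, by linarith [min_le_right ε (y - t)]⟩
      have := hε' (min ε (y - t)) ⟨hmin, min_le_left _ _⟩
      rw [← hφ.add hL] at this
      exact (interior_subset this : φ _ x ∈ K)
    exact hsub ⟨hT, le_rfl⟩
  refine ⟨hstay, fun t ht x hx => ?_⟩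
  exact hinv (fun t => φ t x) t (hcurve x t fun s hs => hKU (hstay s hs.1 hx))
    (by rw [hφ.zero]; exact hx) t ⟨ht, le_rfl⟩

end Transfer

/-! ### The metric and its factor -/

section Metric

variable {k : WithTop ℕ∞} {F : (Fin n → ℝ) → (Fin n → ℝ)} {φ : ℝ → (Fin n → ℝ) → (Fin n → ℝ)}
  {K : Set (Fin n → ℝ)} {M : (Fin n → ℝ) → Matrix (Fin n) (Fin n) ℝ} {lam : ℝ}
  {β : (Fin n → ℝ) → (Fin n → ℝ) →L[ℝ] ℝ}

/-- The metric `PᵀMP + βᵀβ`, where `P` is the `M`-orthogonal projection along `F` and `β` is a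
covector field. -/
noncomputable def phaseMetric (F : (Fin n → ℝ) → (Fin n → ℝ))
    (M : (Fin n → ℝ) → Matrix (Fin n) (Fin n) ℝ) (β : (Fin n → ℝ) → (Fin n → ℝ) →L[ℝ] ℝ)
    (x : Fin n → ℝ) : Matrix (Fin n) (Fin n) ℝ :=
  Matrix.of fun i j => transverseProj F M x (Pi.single i 1) ⬝ᵥ
      (M x *ᵥ transverseProj F M x (Pi.single j 1)) +
    β x (Pi.single i 1) * β x (Pi.single j 1)

theorem phaseMetric_eq (F : (Fin n → ℝ) → (Fin n → ℝ))
    (M : (Fin n → ℝ) → Matrix (Fin n) (Fin n) ℝ) (β : (Fin n → ℝ) → (Fin n → ℝ) →L[ℝ] ℝ)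
    (x : Fin n → ℝ) : phaseMetric F M β x =
      (LinearMap.toMatrix' (transverseProj F M x : (Fin n → ℝ) →ₗ[ℝ] (Fin n → ℝ)))ᵀ *
        (M x * LinearMap.toMatrix' (transverseProj F M x : (Fin n → ℝ) →ₗ[ℝ] (Fin n → ℝ))) +
      vecMulVec (fun i => β x (Pi.single i 1)) fun i => β x (Pi.single i 1) := by
  ext i j
  simp only [phaseMetric, of_apply, Matrix.add_apply, vecMulVec_apply, mul_apply, transpose_apply,
    dotProduct, mulVec, LinearMap.toMatrix'_apply, ContinuousLinearMap.coe_coe]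

theorem dotProduct_phaseMetric_mulVec (x v : Fin n → ℝ) :
    v ⬝ᵥ (phaseMetric F M β x *ᵥ v) =
      transverseProj F M x v ⬝ᵥ (M x *ᵥ transverseProj F M x v) + β x v ^ 2 := by
  have hβ : v ⬝ᵥ (fun i => β x (Pi.single i 1)) = β x v := by
    conv_rhs => rw [pi_eq_sum_univ' v, map_sum]
    simp [dotProduct]
  rw [phaseMetric_eq, add_mulVec, dotProduct_add, ← mulVec_mulVec, ← mulVec_mulVec,
    LinearMap.toMatrix'_mulVec, mulVec_transpose, dotProduct_comm v (_ ᵥ* _), ← dotProduct_mulVec,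
    LinearMap.toMatrix'_mulVec, vecMulVec_mulVec, dotProduct_comm (_ *ᵥ _)]
  simp [hβ, dotProduct_comm _ v]
  ring

theorem phaseMetric_isSymm {x : Fin n → ℝ} (hM : (M x).IsSymm) :
    (phaseMetric F M β x).IsSymm := by
  ext i j
  simp only [phaseMetric, transpose_apply, of_apply]
  rw [dotProduct_mulVec_comm_of_isSymm hM, mul_comm (β x _)]

theorem phaseMetric_pos (hM : UniformlyPosDefOn M K) {x : Fin n → ℝ} (hx : x ∈ K)
    (hβ : β x (F x) = 1) {v : Fin n → ℝ} (hv : v ≠ 0) :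
    0 < v ⬝ᵥ (phaseMetric F M β x *ᵥ v) := by
  rw [dotProduct_phaseMetric_mulVec]
  by_cases hp : transverseProj F M x v = 0
  · have hv' : v = transverseForm F M x v • F x := by
      rw [transverseProj_apply, sub_eq_zero] at hp
      exact hp
    have hβv : β x v = transverseForm F M x v := by
      conv_lhs => rw [hv']
      rw [map_smul, hβ, smul_eq_mul, mul_one]
    have h0 : β x v ≠ 0 := fun h0 => hv (by rw [hv', ← hβv, h0, zero_smul])
    rw [hp, zero_dotProduct, zero_add]
    positivity
  · have := hM.pos hx hp
    positivity

theorem contDiffOn_phaseMetric {U : Set (Fin n → ℝ)} (hF : ContDiff ℝ k F)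
    (hα : ContDiffOn ℝ k (transverseForm F M) U)
    (hM : ∀ i j, ContDiffOn ℝ k (fun x => M x i j) U) (hβ : ContDiffOn ℝ k β U) (i j : Fin n) :
    ContDiffOn ℝ k (fun x => phaseMetric F M β x i j) U := by
  have hP : ∀ i l, ContDiffOn ℝ k (fun x => transverseProj F M x (Pi.single i 1) l) U :=
    fun i => contDiffOn_pi.1 ((contDiffOn_transverseProj hF hα).clm_apply contDiffOn_const)
  have hb : ∀ i, ContDiffOn ℝ k (fun x => β x (Pi.single i 1)) U :=
    fun i => hβ.clm_apply contDiffOn_const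
  simp only [phaseMetric, of_apply, dotProduct, mulVec]
  exact (ContDiffOn.sum fun a _ => (hP i a).mul
    (ContDiffOn.sum fun b _ => (hM a b).mul (hP j b))).add ((hb i).mul (hb j))

/-- On a compact set a continuous positive definite matrix field is uniformly so. -/
theorem uniformlyPosDefOn_of_pos {W : (Fin n → ℝ) → Matrix (Fin n) (Fin n) ℝ} (hK : IsCompact K)
    (hW : ∀ i j, ContinuousOn (fun x => W x i j) K) (hsymm : ∀ x ∈ K, (W x).IsSymm)
    (hpos : ∀ x ∈ K, ∀ v : Fin n → ℝ, v ≠ 0 → 0 < v ⬝ᵥ (W x *ᵥ v)) : UniformlyPosDefOn W K := by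
  refine ⟨hsymm, ?_⟩
  have hS : IsCompact {v : Fin n → ℝ | v ⬝ᵥ v = 1} := by
    refine Metric.isCompact_of_isClosed_isBounded
      (isClosed_eq (by simp only [dotProduct]; fun_prop) continuous_const)
      (isBounded_iff_forall_norm_le.2 ⟨1, fun v hv => ?_⟩)
    have h1 := norm_sq_le_dotProduct v
    rw [show v ⬝ᵥ v = 1 from hv] at h1
    nlinarith [norm_nonneg v]
  have hcont : ContinuousOn (fun p : (Fin n → ℝ) × (Fin n → ℝ) => p.2 ⬝ᵥ (W p.1 *ᵥ p.2))
      (K ×ˢ {v | v ⬝ᵥ v = 1}) := by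
    simp only [dotProduct, mulVec]
    have hpr : ∀ i, Continuous fun p : (Fin n → ℝ) × (Fin n → ℝ) => p.2 i := fun i => by fun_prop
    exact continuousOn_finsetSum _ fun i _ => (hpr i).continuousOn.mul
      (continuousOn_finsetSum _ fun j _ => ((hW i j).comp continuous_fst.continuousOn
        fun p hp => hp.1).mul (hpr j).continuousOn)
  obtain ⟨a, ha, hle⟩ := (hK.prod hS).exists_forall_le' hcont (a := 0) (fun p hp => by
    refine hpos _ hp.1 _ fun h0 => ?_
    have h1 : p.2 ⬝ᵥ p.2 = 1 := hp.2
    rw [h0, zero_dotProduct] at h1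
    exact zero_ne_one h1)
  refine ⟨a, ha, fun x hx v => ?_⟩
  by_cases hv : v = 0
  · simp [hv]
  have hvv : 0 < v ⬝ᵥ v := lt_of_lt_of_le (by positivity) (norm_sq_le_dotProduct v)
  have hr : √(v ⬝ᵥ v) * √(v ⬝ᵥ v) = v ⬝ᵥ v := Real.mul_self_sqrt hvv.le
  have hr0 : √(v ⬝ᵥ v) ≠ 0 := (Real.sqrt_pos.2 hvv).ne'
  have h := hle (x, (√(v ⬝ᵥ v))⁻¹ • v) ⟨hx, by
    change (_ • v) ⬝ᵥ (_ • v) = 1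
    rw [smul_dotProduct, dotProduct_smul, smul_eq_mul, smul_eq_mul, ← mul_assoc, ← mul_inv, hr,
      inv_mul_cancel₀ hvv.ne']⟩
  simp only [mulVec_smul, smul_dotProduct, dotProduct_smul, smul_eq_mul] at h
  rw [← mul_assoc, ← mul_inv, hr] at h
  rwa [le_inv_mul_iff₀ hvv, mul_comm] at h

theorem dotProduct_transpose_mul_self (A : Matrix (Fin n) (Fin n) ℝ) (v : Fin n → ℝ) :
    (A *ᵥ v) ⬝ᵥ (A *ᵥ v) = v ⬝ᵥ ((Aᵀ * A) *ᵥ v) := by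
  rw [← mulVec_mulVec, mulVec_transpose, dotProduct_comm v, ← dotProduct_mulVec]

theorem eq_of_hasDerivAt_of_eqOn_Ici {a b : ℝ → ℝ} {a' b' : ℝ} (ha : HasDerivAt a a' 0)
    (hb : HasDerivAt b b' 0) (h : EqOn a b (Ici 0)) : a' = b' :=
  (uniqueDiffWithinAt_Ici (0 : ℝ)).eq_deriv _ ha.hasDerivWithinAt
    (hb.hasDerivWithinAt.congr h (h self_mem_Ici))

/-- The quadratic form of the generalized Jacobian is half the rate of change of the squared
length of a transported tangent vector in the new coordinates. -/
theorem hasDerivAt_generalizedJacobian (hφ : IsFlow F φ) (hF : ContDiff ℝ 1 F) {L : NNReal}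
    (hL : LipschitzWith L F) {Θ : (Fin n → ℝ) → Matrix (Fin n) (Fin n) ℝ} {x : Fin n → ℝ}
    (hΘ : ∀ i j, DifferentiableAt ℝ (fun y => Θ y i j) x) (hdet : IsUnit (Θ x).det)
    (v : Fin n → ℝ) :
    HasDerivAt (fun t => (Θ (φ t x) *ᵥ fderiv ℝ (φ t) x v) ⬝ᵥ (Θ (φ t x) *ᵥ fderiv ℝ (φ t) x v))
      (2 * ((Θ x *ᵥ v) ⬝ᵥ (generalizedJacobian F Θ x *ᵥ (Θ x *ᵥ v)))) 0 := by
  have hw := hφ.hasDerivAt_fderiv hF hL x v 0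
  have hΘt := hφ.hasDerivAt_matrix (A := Θ) (x := x) (t := 0)
    (by rw [hφ.zero]; exact hΘ)
  have h0 : φ 0 = id := funext hφ.zero
  simp only [h0, id, fderiv_id, ContinuousLinearMap.id_apply] at hw hΘt
  have hz : HasDerivAt (fun t => Θ (φ t x) *ᵥ fderiv ℝ (φ t) x v)
      (flowDeriv F Θ x *ᵥ v + Θ x *ᵥ fderiv ℝ F x v) 0 := by
    refine hasDerivAt_pi.2 fun i => ?_
    have h := HasDerivAt.fun_sum (u := Finset.univ) fun j _ =>
      (hΘt i j).mul (hasDerivAt_pi.1 hw j)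
    refine h.congr_deriv ?_
    simp [h0, Finset.sum_add_distrib, mulVec, dotProduct]
  have hJ : generalizedJacobian F Θ x *ᵥ (Θ x *ᵥ v) =
      flowDeriv F Θ x *ᵥ v + Θ x *ᵥ fderiv ℝ F x v := by
    rw [generalizedJacobian, mulVec_mulVec, Matrix.mul_assoc, nonsing_inv_mul _ hdet,
      Matrix.mul_one, add_mulVec, ← mulVec_mulVec, jacobian_mulVec, add_comm]
  have h := hz.dotProduct_mulVec (A := fun _ => 1) (A' := 0)
    (fun i j => by simpa using hasDerivAt_const _ _) hz
  simp only [one_mulVec, zero_mulVec, dotProduct_zero, add_zero] at h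
  refine h.congr_deriv ?_
  rw [hJ]
  simp only [h0, id, fderiv_id, ContinuousLinearMap.id_apply]
  rw [dotProduct_comm]
  ring

end Metric

end TransverseContraction

open TransverseContraction in
theorem theorem1 (n : ℕ) (hn : 2 ≤ n) (k : ℕ∞) (hk : 1 ≤ k)
    (f : (Fin n → ℝ) → (Fin n → ℝ)) (hf : ContDiff ℝ ((k + 1 : ℕ∞) : WithTop ℕ∞) f)
    (K : Set (Fin n → ℝ))
    (hK : TransverseContraction.IsCompactTransverseContractionRegion (k : WithTop ℕ∞) f K)
    (hne : ∀ x ∈ K, f x ≠ 0) :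
    ∃ Θ : (Fin n → ℝ) → Matrix (Fin n) (Fin n) ℝ,
      TransverseContraction.IsDifferentialChangeOfCoordinates (k : WithTop ℕ∞) Θ K ∧
      ∃ c : ℝ, 0 < c ∧ ∀ x ∈ K,
        TransverseContraction.symEigenvalue
          (TransverseContraction.generalizedJacobian f Θ x) ⟨0, by omega⟩ = 0 ∧
        TransverseContraction.symEigenvalue
          (TransverseContraction.generalizedJacobian f Θ x) ⟨1, by omega⟩ ≤ -c := by
  obtain ⟨hKc, hinvf, M, lam, hlam, hMf⟩ := hK
  have hk1 : (1 : WithTop ℕ∞) ≤ k := by exact_mod_cast hk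
  have hk0 : (k : WithTop ℕ∞) ≠ 0 := (lt_of_lt_of_le one_pos hk1).ne'
  have hkk : (k : WithTop ℕ∞) ≤ ((k + 1 : ℕ∞) : WithTop ℕ∞) := by exact_mod_cast le_self_add
  obtain ⟨F, hF, hFc, U₀, hU₀, hKU₀, hFf⟩ := exists_cutoff hf hKc
  have hFk : ContDiff ℝ k F := hF.of_le hkk
  have hF1 : ContDiff ℝ 1 F := hFk.of_le hk1
  obtain ⟨L, B, hL, hB⟩ := exists_lipschitz_bound_of_hasCompactSupport hF1 hFc
  obtain ⟨φ, hφ⟩ := exists_isFlow hL hB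
  obtain ⟨hinv, hint⟩ := hinvf.mapsTo_flow hKc.isClosed hφ hL hU₀ hKU₀ hFf
  have hM := hMf.congr hU₀ hKU₀ hFf
  have hneF : ∀ x ∈ K, F x ≠ 0 := fun x hx => by rw [hFf (hKU₀ hx)]; exact hne x hx
  obtain ⟨β, V, hV, hKV, hβV, hβF, hβinv⟩ :=
    exists_invariantForm hk hφ hF hL hKc hlam hM hneF hinv hint
  obtain ⟨U, hU, hKU, hα, hMU⟩ := exists_contDiffOn_transverseForm hFk hM.smooth hM.posDef hneF
  have hWpos : ∀ x ∈ K, ∀ v : Fin n → ℝ, v ≠ 0 → 0 < v ⬝ᵥ (phaseMetric F M β x *ᵥ v) :=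
    fun x hx v hv => phaseMetric_pos hM.posDef hx (hβF x hx) hv
  obtain ⟨Θ, U', hU', hKU', hΘ, hΘW⟩ := exists_smooth_cholesky (W := phaseMetric F M β)
    (hU.inter hV) (subset_inter hKU hKV)
    (contDiffOn_phaseMetric hFk (hα.mono inter_subset_left)
      (fun i j => (hMU i j).mono inter_subset_left) (hβV.mono inter_subset_right))
    (fun x hx => phaseMetric_isSymm (hM.posDef.1 x hx)) hWpos
  have hΘc : ∀ i j, ContinuousOn (fun x => Θ x i j) K :=
    fun i j => (hΘ i j).continuousOn.mono hKU'
  refine ⟨Θ, ⟨⟨U', hU', hKU', hΘ⟩, uniformlyPosDefOn_of_pos hKc (fun i j => ?_) (fun x _ => ?_)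
    fun x hx v hv => ?_⟩, lam, hlam, fun x hx => ?_⟩
  · simp only [mul_apply, transpose_apply]
    exact continuousOn_finsetSum _ fun l _ => (hΘc l i).mul (hΘc l j)
  · exact isSymm_transpose_mul_self _
  · rw [hΘW x hx]
    exact hWpos x hx v hv
  have hlen : ∀ y ∈ K, ∀ v, (Θ y *ᵥ v) ⬝ᵥ (Θ y *ᵥ v) =
      transverseProj F M y v ⬝ᵥ (M y *ᵥ transverseProj F M y v) + β y v ^ 2 := fun y hy v => by
    rw [dotProduct_transpose_mul_self, hΘW y hy, dotProduct_phaseMetric_mulVec]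
  have hdet : IsUnit (Θ x).det := by
    rw [← isUnit_iff_isUnit_det, ← mulVec_injective_iff_isUnit]
    refine (injective_iff_map_eq_zero (mulVecLin (Θ x))).2 fun v hv => ?_
    by_contra hv0
    have h := hWpos x hx v hv0
    rw [← hΘW x hx, ← dotProduct_transpose_mul_self, show Θ x *ᵥ v = 0 from hv,
      zero_dotProduct] at h
    exact lt_irrefl _ h
  have hgen : generalizedJacobian f Θ x = generalizedJacobian F Θ x := by
    rw [generalizedJacobian, generalizedJacobian, jacobian_congr hU₀ hFf (hKU₀ hx),
      flowDeriv_congr (hFf (hKU₀ hx))]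
  rw [hgen]
  have hder := fun v => hasDerivAt_generalizedJacobian hφ hF1 hL
    (fun i j => ((hΘ i j).differentiableOn hk0).differentiableAt (hU'.mem_nhds (hKU' hx))) hdet v
  have h0 : φ 0 = id := funext hφ.zero
  have hform : ∀ v, (Θ x *ᵥ v) ⬝ᵥ (generalizedJacobian F Θ x *ᵥ (Θ x *ᵥ v)) ≤
      -lam * (transverseProj F M x v ⬝ᵥ (M x *ᵥ transverseProj F M x v)) := by
    intro v
    obtain ⟨E', hE', hle⟩ := hasDerivAt_transverseEnergy hk1 hφ hFk hL hM hneF (x := x) (t := 0)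
      (by rw [hφ.zero]; exact hx) v
    -- the `β`-component of a transported vector is constant
    have h := eq_of_hasDerivAt_of_eqOn_Ici (hder v) (hE'.add_const (β x v ^ 2)) fun t ht => by
      rw [hlen _ (hinv t ht hx), ← ContinuousLinearMap.comp_apply (β (φ t x)), hβinv x hx t ht]
    simp only [h0, id, fderiv_id, ContinuousLinearMap.id_apply] at hle
    linarith
  have hsurj : ∀ y, Θ x *ᵥ ((Θ x)⁻¹ *ᵥ y) = y := fun y => by
    rw [mulVec_mulVec, mul_nonsing_inv _ hdet, one_mulVec]
  have hnn : ∀ v, 0 ≤ transverseProj F M x v ⬝ᵥ (M x *ᵥ transverseProj F M x v) := by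
    intro v
    by_cases hp : transverseProj F M x v = 0
    · simp [hp]
    · exact (hM.posDef.pos hx hp).le
  -- transported along the flow, the vector field keeps unit length in the new coordinates
  have hlenF : ∀ y ∈ K, (Θ y *ᵥ F y) ⬝ᵥ (Θ y *ᵥ F y) = 1 := by
    intro y hy
    rw [hlen y hy, transverseProj_apply, transverseForm_self hM.posDef hneF hy, hβF y hy]
    simp
  refine symEigenvalue_of_form (two_pos.trans_le hn) (one_lt_two.trans_le hn) hlam
    (y₀ := Θ x *ᵥ F x) (fun y => ?_) (fun h => ?_) ?_
    ((β x : (Fin n → ℝ) →ₗ[ℝ] ℝ) ∘ₗ mulVecLin (Θ x)⁻¹) fun y hy => ?_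
  · have h1 := hform ((Θ x)⁻¹ *ᵥ y)
    rw [hsurj] at h1
    nlinarith [hnn ((Θ x)⁻¹ *ᵥ y)]
  · have h1 := hlenF x hx
    rw [h, zero_dotProduct] at h1
    exact zero_ne_one h1
  · have h1 := eq_of_hasDerivAt_of_eqOn_Ici (hder (F x)) (hasDerivAt_const 0 1) fun t ht => by
      rw [hφ.fderiv_apply_self hF1 hL, hlenF _ (hinv t ht hx)]
    linarith
  · have h1 := hform ((Θ x)⁻¹ *ᵥ y)
    have h2 := hlen x hx ((Θ x)⁻¹ *ᵥ y)
    have h3 : β x ((Θ x)⁻¹ *ᵥ y) = 0 := hy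
    rw [hsurj] at h1 h2
    rw [h3] at h2
    rw [h2]
    linarith
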